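/- Let $\mathbf{k}$ be a field of characteristic zero. All operads are symmetric operads $P=(P(l))_{l\ge 0}$ in $\mathbb{Z}$-graded $\mathbf{k}$-vector spaces (graded operads) or in cochain complexes of $\mathbf{k}$-vector spaces, with differential of degree $+1$ (dg operads); arity zero is allowed. $\Gamma(M)$ denotes the free graded operad on a graded $\Sigma$-module $M$, and $I$ the initial dg operad. A morphism of dg operads is a quasi-isomorphism if it induces an isomorphism in cohomology in every arity. Let $n\ge 2$, and let $Q$ be a dg operad which as a graded operad is free, $Q=\Gamma(M)$, on a graded $\Sigma$-module $M$ with $M(0)=M(1)=0$. Let $E$ be a graded $\Sigma$-module concentrated in arity $n$ and let $d\colon E\to ZQ(n)$ be a $\Sigma_n$-equivariant map of degree $+1$ into the cocycles. The arity $n$ principal extension $Q\to Q\sqcup_d\Gamma(E)$ is the graded operad $\Gamma(M\oplus E)$ with the differential that extends the differential of $Q$ and $d$ by the Leibniz rule. A Sullivan minimal operad is a colimit $P_\infty=\varinjlim_n P_n$ of a sequence of dg operads $$I=P_1\to P_2\to P_3\to\cdots$$ in which each $P_{n-1}\to P_n=P_{n-1}\sqcup_{d_n}\Gamma(E(n))$,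 $n\ge 2$, is an arity $n$ principal extension ($E(n)=0$ is allowed). A Sullivan minimal model of a dg operad $P$ is a Sullivan minimal operad $P_\infty$ together with a quasi-isomorphism of dg operads $P_\infty\to P$. **Theorem.** Let $P$ be a dg operad over $\mathbf{k}$ such that $HP(0)=0$ and $HP(1)=\mathbf{k}$ (that is, the unit of $P$ induces an isomorphism $\mathbf{k}\to HP(1)$). Then $P$ has a Sullivan minimal model $P_\infty\to P$. Moreover, as a graded operad $P_\infty$ is free on a graded $\Sigma$-module concentrated in arities $\ge 2$, $P_\infty(0)=0$, and $P_\infty(1)=\mathbf{k}$ (the unit $\mathbf{k}\to P_\infty(1)$ is an isomorphism). -/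

import Mathlib

open CategoryTheory CategoryTheory.Limits

universe u

/-! ### Graded symmetric modules

Graded vector spaces are encoded by a vector space together with a decomposition as an internal
direct sum, over `ℤ`, of subspaces. -/

/-- A graded `Σ`-module over `k`: for each arity `n` a `ℤ`-graded `k`-vector space `obj n`, whose
degree `p` part is `deg n p`, with a right action `x ↦ act n σ x` of the symmetric group of
`{0, …, n-1}` by degree-preserving linear maps. -/
structure GradedSigmaModule (k : Type u) [Field k] where
  obj : ℕ → Type u
  [instAddCommGroup : ∀ n, AddCommGroup (obj n)]
  [instModule : ∀ n, Module k (obj n)]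
  deg : ∀ n, ℤ → Submodule k (obj n)
  isInternal : ∀ n, DirectSum.IsInternal (deg n)
  act : ∀ n, Equiv.Perm (Fin n) → obj n →ₗ[k] obj n
  act_one : ∀ n x, act n 1 x = x
  act_mul : ∀ n σ τ x, act n (σ * τ) x = act n τ (act n σ x)
  act_mem : ∀ n σ p x, x ∈ deg n p → act n σ x ∈ deg n p

attribute [instance] GradedSigmaModule.instAddCommGroup GradedSigmaModule.instModule

namespace GradedSigmaModule

variable {k : Type u} [Field k]

/-- Morphisms of graded `Σ`-modules: equivariant linear maps of degree zero in each arity. -/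
@[ext]
structure Hom (M N : GradedSigmaModule k) where
  app : ∀ n, M.obj n →ₗ[k] N.obj n
  app_mem : ∀ n p x, x ∈ M.deg n p → app n x ∈ N.deg n p
  app_act : ∀ n σ x, app n (M.act n σ x) = N.act n σ (app n x)

/-- Composition (first `f`, then `g`). -/
def Hom.comp {M N L : GradedSigmaModule k} (f : Hom M N) (g : Hom N L) : Hom M L where
  app n := (g.app n).comp (f.app n)
  app_mem n p x hx := g.app_mem n p _ (f.app_mem n p x hx)
  app_act n σ x := by simp [f.app_act, g.app_act]

theorem isInternal_prod {V W : Type u} [AddCommGroup V] [Module k V] [AddCommGroup W] [Module k W]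
    {A : ℤ → Submodule k V} {B : ℤ → Submodule k W} (hA : DirectSum.IsInternal A)
    (hB : DirectSum.IsInternal B) : DirectSum.IsInternal (fun p => (A p).prod (B p)) := by
  rw [DirectSum.isInternal_submodule_iff_iSupIndep_and_iSup_eq_top] at *
  constructor
  · intro i
    rw [Submodule.disjoint_def]
    rintro ⟨x, y⟩ hx hxy
    have hle : (⨆ j, ⨆ (_ : j ≠ i), (A j).prod (B j)) ≤
        (⨆ j, ⨆ (_ : j ≠ i), A j).prod (⨆ j, ⨆ (_ : j ≠ i), B j) :=
      iSup₂_le fun j hj => Submodule.prod_mono (le_iSup₂_of_le j hj le_rfl)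
        (le_iSup₂_of_le j hj le_rfl)
    have h2 := hle hxy
    rw [Submodule.mem_prod] at hx h2
    have hx0 := (Submodule.disjoint_def.1 (hA.1 i)) x hx.1 h2.1
    have hy0 := (Submodule.disjoint_def.1 (hB.1 i)) y hx.2 h2.2
    simp [hx0, hy0]
  · rw [eq_top_iff]
    rintro ⟨x, y⟩ -
    have h1 : (x, (0 : W)) ∈ ⨆ p, (A p).prod (B p) := by
      have : x ∈ ⨆ p, A p := hA.2 ▸ Submodule.mem_top
      have hm := Submodule.mem_map_of_mem (f := LinearMap.inl k V W) this
      rw [Submodule.map_iSup] at hm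
      refine (iSup_mono fun p => ?_ : _ ≤ ⨆ p, (A p).prod (B p)) hm
      rintro _ ⟨v, hv, rfl⟩
      exact ⟨hv, (B p).zero_mem⟩
    have h2 : ((0 : V), y) ∈ ⨆ p, (A p).prod (B p) := by
      have : y ∈ ⨆ p, B p := hB.2 ▸ Submodule.mem_top
      have hm := Submodule.mem_map_of_mem (f := LinearMap.inr k V W) this
      rw [Submodule.map_iSup] at hm
      refine (iSup_mono fun p => ?_ : _ ≤ ⨆ p, (A p).prod (B p)) hm
      rintro _ ⟨v, hv, rfl⟩
      exact ⟨(A p).zero_mem, hv⟩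
    simpa using Submodule.add_mem _ h1 h2

/-- The direct sum `M ⊕ E` of graded `Σ`-modules. -/
def sum (M E : GradedSigmaModule k) : GradedSigmaModule k where
  obj n := M.obj n × E.obj n
  deg n p := (M.deg n p).prod (E.deg n p)
  isInternal n := isInternal_prod (M.isInternal n) (E.isInternal n)
  act n σ := (M.act n σ).prodMap (E.act n σ)
  act_one n x := by simp [M.act_one, E.act_one]
  act_mul n σ τ x := by simp [M.act_mul, E.act_mul]
  act_mem n σ p x hx := ⟨M.act_mem n σ p _ hx.1, E.act_mem n σ p _ hx.2⟩

/-- The morphism `M ⊕ E → N` with components `f` and `g`. -/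
def Hom.coprod {M E N : GradedSigmaModule k} (f : Hom M N) (g : Hom E N) : Hom (M.sum E) N where
  app n := (f.app n).coprod (g.app n)
  app_mem n p x hx := by
    exact (N.deg n p).add_mem (f.app_mem n p _ hx.1) (g.app_mem n p _ hx.2)
  app_act n σ x := by
    change f.app n (M.act n σ x.1) + g.app n (E.act n σ x.2) = N.act n σ (f.app n x.1 + g.app n x.2)
    rw [map_add, f.app_act, g.app_act]

end GradedSigmaModule

/-! ### Inputs of a partial composite

When an operation `y` with `m` inputs is inserted at input `i` of an operation `x` with `l` inputs,
the result has `n = l + m - 1` inputs: the inputs of `x` other than `i`, and the inputs of `y`,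
where the latter occupy the place of `i`. All inputs are numbered from zero. -/

/-- The position in the composite of an input `a ≠ i` of `x`, or of an input `b` of `y`. -/
def slot {l m n : ℕ} (h : n + 1 = l + m) (i : Fin l) : {a : Fin l // a ≠ i} ⊕ Fin m → Fin n
  | Sum.inl a => ⟨if a.1 < i then a.1.1 else a.1.1 + m - 1, by
      have h1 := a.1.2
      have h2 := i.2
      have h3 : a.1.1 ≠ i.1 := fun e => a.2 (Fin.ext e)
      split_ifs with h4
      · have : a.1.1 < i.1 := h4
        omega
      · have : ¬ a.1.1 < i.1 := h4
        omega⟩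
  | Sum.inr b => ⟨i.1 + b.1, by
      have h1 := b.2
      have h2 := i.2
      omega⟩

theorem slot_bijective {l m n : ℕ} (h : n + 1 = l + m) (i : Fin l) :
    Function.Bijective (slot h i) := by
  rw [Fintype.bijective_iff_injective_and_card]
  constructor
  · rintro (⟨a, ha⟩ | b) (⟨a', ha'⟩ | b') hab
    all_goals
      simp only [slot, Fin.mk.injEq, Fin.lt_def] at hab
      simp only [ne_eq] at *
    · have : a.1 = a'.1 := by split_ifs at hab <;> omega
      have : a = a' := Fin.ext this
      subst this
      rfl
    · exfalso
      have := b'.2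
      split_ifs at hab <;> omega
    · exfalso
      have := b.2
      split_ifs at hab <;> omega
    · have : b = b' := Fin.ext (by omega)
      rw [this]
  · have hi := i.2
    have : Fintype.card {a : Fin l // a ≠ i} = l - 1 := by
      simp [Fintype.card_subtype_compl]
    simp only [Fintype.card_sum, this, Fintype.card_fin]
    omega

/-- `slot` as a bijection. -/
noncomputable def slotEquiv {l m n : ℕ} (h : n + 1 = l + m) (i : Fin l) :
    {a : Fin l // a ≠ i} ⊕ Fin m ≃ Fin n :=
  Equiv.ofBijective (slot h i) (slot_bijective h i)

/-- The permutation of the inputs of a partial composite at input `i` that is induced by a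
permutation `σ` of the inputs of the outer operation and a permutation `τ` of the inputs of the
inner one: the position of `a ≠ i` goes to the position of `σ a`, and the position of `b` to the
position of `τ b`, where the target positions are those for the insertion at input `σ i`. -/
noncomputable def blockPerm {l m n : ℕ} (h : n + 1 = l + m) (i : Fin l)
    (σ : Equiv.Perm (Fin l)) (τ : Equiv.Perm (Fin m)) : Equiv.Perm (Fin n) :=
  (slotEquiv h i).symm.trans
    ((Equiv.sumCongr
      (σ.subtypeEquiv (p := fun a => a ≠ i) (q := fun a => a ≠ σ i) (fun a => by simp)) τ).trans
      (slotEquiv h (σ i)))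

/-! ### Operads -/

/-- A graded (symmetric) operad over `k`, given by partial compositions
`x ∘ᵢ y = comp h i x y ∈ P(n)` for `x ∈ P(l)`, `y ∈ P(m)`, `n = l + m - 1`, and a unit
`one ∈ P(1)`. -/
structure GradedOperad (k : Type u) [Field k] extends GradedSigmaModule k where
  comp : ∀ {l m n : ℕ}, n + 1 = l + m → Fin l → (obj l →ₗ[k] obj m →ₗ[k] obj n)
  comp_mem : ∀ {l m n : ℕ} (h : n + 1 = l + m) (i : Fin l) (p q : ℤ) (x : obj l) (y : obj m),
    x ∈ deg l p → y ∈ deg m q → comp h i x y ∈ deg n (p + q)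
  one : obj 1
  one_mem : one ∈ deg 1 0
  /-- `id ∘₀ x = x`. -/
  one_comp : ∀ {n : ℕ} (h : n + 1 = 1 + n) (x : obj n), comp h 0 one x = x
  /-- `x ∘ᵢ id = x`. -/
  comp_one : ∀ {n : ℕ} (h : n + 1 = n + 1) (i : Fin n) (x : obj n), comp h i x one = x
  /-- Sequential associativity: `(x ∘ᵢ y) ∘ᵢ₊ⱼ z = x ∘ᵢ (y ∘ⱼ z)`. -/
  comp_assoc : ∀ {l m n a b c : ℕ} (hlm : a + 1 = l + m) (han : c + 1 = a + n)
    (hmn : b + 1 = m + n) (hlb : c + 1 = l + b) (i : Fin l) (j : Fin m) (s : Fin a)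
    (x : obj l) (y : obj m) (z : obj n), s.1 = i.1 + j.1 →
    comp han s (comp hlm i x y) z = comp hlb i x (comp hmn j y z)
  /-- Parallel associativity: for inputs `i < j` of `x`,
  `(x ∘ᵢ y) ∘ⱼ₊ₘ₋₁ z = (-1)^(|y||z|) (x ∘ⱼ z) ∘ᵢ y`. -/
  comp_comm : ∀ {l m n a b c : ℕ} (hlm : a + 1 = l + m) (han : c + 1 = a + n)
    (hln : b + 1 = l + n) (hbm : c + 1 = b + m) (i j : Fin l) (s : Fin a) (t : Fin b)
    (p q : ℤ) (x : obj l) (y : obj m) (z : obj n), i < j → s.1 + 1 = j.1 + m → t.1 = i.1 →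
    y ∈ deg m p → z ∈ deg n q →
    comp han s (comp hlm i x y) z = (p * q).negOnePow • comp hbm t (comp hln j x z) y
  /-- Equivariance: `(x σ) ∘ᵢ (y τ) = (x ∘_{σ i} y) (σ ∘ᵢ τ)`. -/
  comp_act : ∀ {l m n : ℕ} (h : n + 1 = l + m) (i : Fin l) (σ : Equiv.Perm (Fin l))
    (τ : Equiv.Perm (Fin m)) (x : obj l) (y : obj m),
    comp h i (act l σ x) (act m τ y) = act n (blockPerm h i σ τ) (comp h (σ i) x y)

namespace GradedOperad

variable {k : Type u} [Field k]

/-- Morphisms of graded operads. -/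
@[ext]
structure Hom (P Q : GradedOperad k) extends
    toSigmaHom : GradedSigmaModule.Hom P.toGradedSigmaModule Q.toGradedSigmaModule where
  app_one : app 1 P.one = Q.one
  app_comp : ∀ {l m n : ℕ} (h : n + 1 = l + m) (i : Fin l) (x : P.obj l) (y : P.obj m),
    app n (P.comp h i x y) = Q.comp h i (app l x) (app m y)

/-- A graded operad `P` together with a morphism of graded `Σ`-modules `i : M → P` is the free
graded operad `Γ(M)` on `M` if every morphism of graded `Σ`-modules from `M` to a graded operad
extends uniquely to a morphism of graded operads on `P`. -/
def IsFreeOn {M : GradedSigmaModule k} {P : GradedOperad k}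
    (i : GradedSigmaModule.Hom M P.toGradedSigmaModule) : Prop :=
  ∀ (Q : GradedOperad k) (f : GradedSigmaModule.Hom M Q.toGradedSigmaModule),
    ∃! g : Hom P Q, i.comp g.toSigmaHom = f

end GradedOperad

/-- A dg operad over `k`: a graded operad with differentials of degree `+1` in each arity that are
equivariant and satisfy the Leibniz rule for partial compositions. -/
structure DGOperad (k : Type u) [Field k] extends GradedOperad k where
  diff : ∀ n, obj n →ₗ[k] obj n
  diff_mem : ∀ n p x, x ∈ deg n p → diff n x ∈ deg n (p + 1)
  diff_diff : ∀ n x, diff n (diff n x) = 0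
  diff_act : ∀ n σ x, diff n (act n σ x) = act n σ (diff n x)
  diff_comp : ∀ {l m n : ℕ} (h : n + 1 = l + m) (i : Fin l) (p : ℤ) (x : obj l) (y : obj m),
    x ∈ deg l p → diff n (comp h i x y) =
      comp h i (diff l x) y + p.negOnePow • comp h i x (diff m y)

namespace DGOperad

variable {k : Type u} [Field k]

/-- Morphisms of dg operads. -/
@[ext]
structure Hom (P Q : DGOperad k) extends
    toGradedHom : GradedOperad.Hom P.toGradedOperad Q.toGradedOperad where
  app_diff : ∀ n x, app n (P.diff n x) = Q.diff n (app n x)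

/-- The category of dg operads. -/
instance : Category (DGOperad k) where
  Hom P Q := Hom P Q
  id P :=
    { app := fun _ => LinearMap.id
      app_mem := fun _ _ _ hx => hx
      app_act := fun _ _ _ => rfl
      app_one := rfl
      app_comp := fun _ _ _ _ => rfl
      app_diff := fun _ _ => rfl }
  comp f g :=
    { f.toSigmaHom.comp g.toSigmaHom with
      app_one := by simp [GradedSigmaModule.Hom.comp, f.app_one, g.app_one]
      app_comp := fun h i x y => by simp [GradedSigmaModule.Hom.comp, f.app_comp, g.app_comp]
      app_diff := fun n x => by simp [GradedSigmaModule.Hom.comp, f.app_diff, g.app_diff] }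

/-- The underlying morphism of graded operads. -/
def gradedHom {P Q : DGOperad k} (φ : P ⟶ Q) : GradedOperad.Hom P.toGradedOperad Q.toGradedOperad :=
  Hom.toGradedHom φ

/-- The component in arity `n` of a morphism of dg operads. -/
def homApp {P Q : DGOperad k} (φ : P ⟶ Q) (n : ℕ) : P.obj n →ₗ[k] Q.obj n :=
  (gradedHom φ).app n

theorem homApp_diff {P Q : DGOperad k} (φ : P ⟶ Q) (n : ℕ) (x : P.obj n) :
    homApp φ n (P.diff n x) = Q.diff n (homApp φ n x) :=
  Hom.app_diff φ n x

/-! ### Cohomology -/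

/-- The cocycles `ZP(n)`. -/
def cocycles (P : DGOperad k) (n : ℕ) : Submodule k (P.obj n) :=
  LinearMap.ker (P.diff n)

/-- The coboundaries `BP(n)`, as a subspace of the cocycles. -/
def coboundaries (P : DGOperad k) (n : ℕ) : Submodule k (P.cocycles n) :=
  (LinearMap.range (P.diff n)).submoduleOf (P.cocycles n)

/-- The total cohomology `HP(n) = ZP(n) / BP(n)`, that is, the direct sum over all degrees. -/
abbrev cohomology (P : DGOperad k) (n : ℕ) : Type u :=
  P.cocycles n ⧸ P.coboundaries n

/-- The map induced on cocycles by a morphism of dg operads. -/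
def cocyclesMap {P Q : DGOperad k} (φ : P ⟶ Q) (n : ℕ) : P.cocycles n →ₗ[k] Q.cocycles n :=
  (homApp φ n).restrict fun x (hx : P.diff n x = 0) => by
    change Q.diff n (homApp φ n x) = 0
    rw [← homApp_diff, hx, map_zero]

/-- The map induced on cohomology by a morphism of dg operads. -/
def cohomologyMap {P Q : DGOperad k} (φ : P ⟶ Q) (n : ℕ) : P.cohomology n →ₗ[k] Q.cohomology n :=
  Submodule.mapQ _ _ (cocyclesMap φ n) <| by
    rintro ⟨x, hx⟩ ⟨y, hy⟩
    exact ⟨homApp φ n y, by rw [← homApp_diff, hy]; rfl⟩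

/-- Quasi-isomorphisms of dg operads. -/
def IsQuasiIso {P Q : DGOperad k} (φ : P ⟶ Q) : Prop :=
  ∀ n, Function.Bijective (cohomologyMap φ n)

theorem diff_one (P : DGOperad k) : P.diff 1 P.one = 0 := by
  have h := P.diff_comp (l := 1) (m := 1) (n := 1) rfl 0 0 P.one P.one P.one_mem
  rw [P.one_comp, P.comp_one, P.one_comp] at h
  simpa using h

/-- The class of the identity operation in `HP(1)`. -/
def oneClass (P : DGOperad k) : P.cohomology 1 :=
  (P.coboundaries 1).mkQ ⟨P.one, P.diff_one⟩

/-- `HP(1) = k`, through the unit of the operad. -/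
def IsCohomologicallyConnected (P : DGOperad k) : Prop :=
  Function.Bijective fun c : k => c • P.oneClass

/-- `HP(0) = 0`. -/
def IsCohomologicallyNonUnitary (P : DGOperad k) : Prop :=
  Subsingleton (P.cohomology 0)

/-- `P(1) = k`, through the unit of the operad. -/
def IsConnected (P : DGOperad k) : Prop :=
  Function.Bijective fun c : k => c • P.one

/-- `P(0) = 0`. -/
def IsNonUnitary (P : DGOperad k) : Prop :=
  Subsingleton (P.obj 0)

/-! ### Principal extensions and Sullivan minimal operads -/

/-- A presentation of a morphism of dg operads `ι : P → Q` as a principal extension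
`P → P ⊔_d Γ(E)` of arity `n ≥ 2`. -/
structure PrincipalExtension (n : ℕ) {P Q : DGOperad k} (ι : P ⟶ Q) where
  two_le : 2 ≤ n
  /-- As a graded operad, `P = Γ(M)`, where `M(0) = M(1) = 0`. -/
  M : GradedSigmaModule k
  M_zero : Subsingleton (M.obj 0)
  M_one : Subsingleton (M.obj 1)
  inc : GradedSigmaModule.Hom M P.toGradedSigmaModule
  inc_free : GradedOperad.IsFreeOn inc
  /-- The new generators, a graded `Σ`-module of homogeneous arity `n`. -/
  E : GradedSigmaModule k
  E_arity : ∀ m, m ≠ n → Subsingleton (E.obj m)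
  /-- The attaching map `E → ZP(n)`, of degree `+1` and equivariant. -/
  d : E.obj n →ₗ[k] P.obj n
  d_mem : ∀ p e, e ∈ E.deg n p → d e ∈ P.deg n (p + 1)
  d_act : ∀ σ e, d (E.act n σ e) = P.act n σ (d e)
  diff_d : ∀ e, P.diff n (d e) = 0
  /-- As a graded operad, `Q = Γ(M ⊕ E)`, and `ι` restricts to the inclusion of `M`. -/
  gen : GradedSigmaModule.Hom E Q.toGradedSigmaModule
  free : GradedOperad.IsFreeOn ((inc.comp (gradedHom ι).toSigmaHom).coprod gen)
  /-- The differential of `Q` restricts to `d` on the new generators. -/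
  diff_gen : ∀ e, Q.diff n (gen.app n e) = homApp ι n (d e)

/-- `S` is a Sullivan minimal operad: the colimit of a sequence of dg operads
`F 0 → F 1 → F 2 → ⋯` where `F 0` is the initial operad and `F r → F (r + 1)` is a
principal extension of arity `r + 2` (generators are added in arities `2, 3, 4, …`, in this
order; the space of generators added in a given arity may be zero). -/
def IsSullivanMinimal (S : DGOperad k) : Prop :=
  ∃ (F : ℕ ⥤ DGOperad.{u} k) (α : F ⟶ (Functor.const ℕ).obj S),
    Nonempty (IsInitial (F.obj 0)) ∧
    (∀ r : ℕ, Nonempty (PrincipalExtension (r + 2) (F.map (homOfLE (Nat.le_succ r))))) ∧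
    Nonempty (IsColimit (Cocone.mk S α))

/-- `ρ : S → P` is a Sullivan minimal model of `P`. -/
def IsSullivanMinimalModel {S P : DGOperad k} (ρ : S ⟶ P) : Prop :=
  IsSullivanMinimal S ∧ IsQuasiIso ρ

end DGOperad

/-! The model is built arity by arity. The initial operad `I` has `I(0) = 0` and `I(1) = k`, so the
hypotheses on `HP(0)` and `HP(1)` say exactly that `I → P` induces isomorphisms on cohomology in
arities 0 and 1.

Suppose `ρ : A → P` is given, with `A` free on generators of arities between 2 and `n - 1`, and is a
cohomology isomorphism in arities below `n`. A cocycle of degree `p` in the mapping cone of `ρ` in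
arity `n` is a pair `(a, x)` with `a` of degree `p + 1`, `x` of degree `p`, `da = 0` and `dx =
ρ(a)`. In characteristic zero the coboundaries have a `Σ_n`-stable complement `E` in the cocycles.
Attach `E` to `A` by `d(a, x) = a` and extend `ρ` by `(a, x) ↦ x`. Since there are no generators of
arity 0 or 1, a composite of total arity at most `n` with two nontrivial factors only involves
arities below `n`. Hence the new operad agrees with `A` below arity `n`, and in arity `n` it is
spanned by `A(n)` and `E`. The attached generators kill the cohomology of the cone, so the extended
map is a cohomology isomorphism in arity `n` too (`step_bijective`), and nothing changes in lower
arities (`step_bijective_of_lt`).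

Arity `m` is unaffected by all later attachments, so the colimit is computed in arity `m` by a
finite stage (`stageToLimit_bijective`). It is therefore a quasi-isomorphic model, free on
generators of arity at least 2.

The free operad is a quotient of formal terms by the operad laws. No normal form by trees is needed:
`FreeOperad.induction` gives spanning statements, and a retraction of generators gives injectivity
(`map_injective`). Derivations are defined on terms and checked against each law (`Rel.deriv_eq`).
-/

namespace GradedSigmaModule

/-! ### Graded modules assembled from their homogeneous parts -/

open DirectSum

variable {k : Type u} [Field k]

theorem isInternal_range_lof (V : ℤ → Type u) [∀ p, AddCommGroup (V p)] [∀ p, Module k (V p)] :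
    DirectSum.IsInternal (fun p => LinearMap.range (lof k ℤ V p)) := by
  classical
  let e : ∀ p, V p ≃ₗ[k] LinearMap.range (lof k ℤ V p) := fun p =>
    LinearEquiv.ofInjective (lof k ℤ V p) (DirectSum.of_injective p)
  let F : (⨁ p, V p) →ₗ[k] ⨁ p, LinearMap.range (lof k ℤ V p) :=
    DirectSum.lmap fun p => (e p).toLinearMap
  let G : (⨁ p, LinearMap.range (lof k ℤ V p)) →ₗ[k] ⨁ p, V p :=
    DirectSum.coeLinearMap fun p => LinearMap.range (lof k ℤ V p)
  have hGF : ∀ x, G (F x) = x := fun x => by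
    have : G ∘ₗ F = LinearMap.id := by
      ext p x : 2
      simp [F, G, e]
      rfl
    exact congrArg (fun f => f x) this
  have hFG : ∀ x, F (G x) = x := fun x => by
    have : F ∘ₗ G = LinearMap.id := by
      ext p x : 2
      obtain ⟨x, y, rfl⟩ := x
      simp [F, G, e]
      rfl
    exact congrArg (fun f => f x) this
  exact ⟨fun x y h => by rw [← hFG x, ← hFG y]; exact congrArg F h, fun x => ⟨F x, hGF x⟩⟩

/-- The graded `Σ`-module with homogeneous parts `V n p`. -/
@[reducible] def ofHomogeneous (V : ℕ → ℤ → Type u) [∀ n p, AddCommGroup (V n p)] [∀ n p, Module k (V n p)]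
    (act : ∀ n p, Equiv.Perm (Fin n) → V n p →ₗ[k] V n p)
    (act_one : ∀ n p x, act n p 1 x = x)
    (act_mul : ∀ n p σ τ x, act n p (σ * τ) x = act n p τ (act n p σ x)) :
    GradedSigmaModule k where
  obj n := ⨁ p, V n p
  deg n p := LinearMap.range (lof k ℤ (V n) p)
  isInternal n := isInternal_range_lof (V n)
  act n σ := DirectSum.lmap fun p => act n p σ
  act_one n x := by
    have : DirectSum.lmap (fun p => act n p 1) = LinearMap.id := by
      ext p x : 2
      simp [act_one]
    exact congrArg (fun f => f x) this
  act_mul n σ τ x := by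
    have : DirectSum.lmap (fun p => act n p (σ * τ)) =
        DirectSum.lmap (fun p => act n p τ) ∘ₗ DirectSum.lmap (fun p => act n p σ) := by
      ext p x : 2
      simp [act_mul]
    exact congrArg (fun f => f x) this
  act_mem n σ p x := by
    rintro ⟨y, rfl⟩
    exact ⟨act n p σ y, by simp⟩

theorem homogeneous_induction (M : GradedSigmaModule k) {n : ℕ} {C : M.obj n → Prop}
    (hom : ∀ p x, x ∈ M.deg n p → C x) (add : ∀ x y, C x → C y → C (x + y)) (x : M.obj n) :
    C x := by
  have hx : x ∈ ⨆ p, M.deg n p := by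
    rw [(M.isInternal n).submodule_iSup_eq_top]
    trivial
  exact Submodule.iSup_induction (motive := C) _ hx hom (hom 0 0 (Submodule.zero_mem _)) add

/-- The linear map with prescribed restrictions to the homogeneous parts. -/
noncomputable def ofDegrees (M : GradedSigmaModule k) {n : ℕ} {W : Type*} [AddCommGroup W]
    [Module k W] (f : ∀ p, M.deg n p →ₗ[k] W) : M.obj n →ₗ[k] W :=
  (DirectSum.toModule k ℤ W f) ∘ₗ
    (LinearEquiv.ofBijective (DirectSum.coeLinearMap (M.deg n)) (M.isInternal n)).symm.toLinearMap

theorem ofDegrees_apply (M : GradedSigmaModule k) {n : ℕ} {W : Type*} [AddCommGroup W]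
    [Module k W] (f : ∀ p, M.deg n p →ₗ[k] W) {p : ℤ} (x : M.deg n p) :
    M.ofDegrees f x = f p x := by
  have h : (LinearEquiv.ofBijective (DirectSum.coeLinearMap (M.deg n)) (M.isInternal n)).symm
      (x : M.obj n) = lof k ℤ (fun p => M.deg n p) p x := by
    rw [LinearEquiv.symm_apply_eq]
    exact (DirectSum.coeLinearMap_lof _ _ _).symm
  simp only [ofDegrees, LinearMap.comp_apply, LinearEquiv.coe_coe, h, toModule_lof]

end GradedSigmaModule

/-! ### The free graded operad, as terms modulo the operad laws -/

namespace FreeOperad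

variable {k : Type u} [Field k]

/-- Homogeneous terms of given arity and degree in the language of operads, with generators from
the homogeneous elements of `M`. -/
inductive Term (M : GradedSigmaModule k) : ℕ → ℤ → Type u
  | gen {n : ℕ} {p : ℤ} (x : M.deg n p) : Term M n p
  | one : Term M 1 0
  -- The degree `r` is a free index tied to `p + q` by an equation, so that the two sides of an
  -- associativity law have the same type without casts.
  | comp {l m n : ℕ} {p q r : ℤ} (h : n + 1 = l + m) (hr : p + q = r) (i : Fin l)
      (a : Term M l p) (b : Term M m q) : Term M n r
  | act {n : ℕ} {p : ℤ} (σ : Equiv.Perm (Fin n)) (a : Term M n p) : Term M n p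
  | zero {n : ℕ} {p : ℤ} : Term M n p
  | add {n : ℕ} {p : ℤ} (a b : Term M n p) : Term M n p
  | smul {n : ℕ} {p : ℤ} (c : k) (a : Term M n p) : Term M n p

/-- The congruence on terms generated by the laws of graded operads. -/
inductive Rel (M : GradedSigmaModule k) : ∀ {n : ℕ} {p : ℤ}, Term M n p → Term M n p → Prop
  | refl {n p} (a : Term M n p) : Rel M a a
  | symm {n p} {a b : Term M n p} : Rel M a b → Rel M b a
  | trans {n p} {a b c : Term M n p} : Rel M a b → Rel M b c → Rel M a c
  | comp_congr {l m n : ℕ} {p q r : ℤ} (h : n + 1 = l + m) (hr : p + q = r) (i : Fin l)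
      {a a' : Term M l p} {b b' : Term M m q} : Rel M a a' → Rel M b b' →
      Rel M (Term.comp h hr i a b) (Term.comp h hr i a' b')
  | act_congr {n p} (σ : Equiv.Perm (Fin n)) {a b : Term M n p} : Rel M a b →
      Rel M (Term.act σ a) (Term.act σ b)
  | add_congr {n p} {a a' b b' : Term M n p} : Rel M a a' → Rel M b b' →
      Rel M (Term.add a b) (Term.add a' b')
  | smul_congr {n p} (c : k) {a b : Term M n p} : Rel M a b → Rel M (Term.smul c a) (Term.smul c b)
  | add_assoc {n p} (a b c : Term M n p) :
      Rel M (Term.add (Term.add a b) c) (Term.add a (Term.add b c))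
  | add_comm {n p} (a b : Term M n p) : Rel M (Term.add a b) (Term.add b a)
  | zero_add {n p} (a : Term M n p) : Rel M (Term.add Term.zero a) a
  | neg_add {n p} (a : Term M n p) : Rel M (Term.add (Term.smul (-1) a) a) Term.zero
  | smul_add {n p} (c : k) (a b : Term M n p) :
      Rel M (Term.smul c (Term.add a b)) (Term.add (Term.smul c a) (Term.smul c b))
  | add_smul {n p} (c c' : k) (a : Term M n p) :
      Rel M (Term.smul (c + c') a) (Term.add (Term.smul c a) (Term.smul c' a))
  | mul_smul {n p} (c c' : k) (a : Term M n p) :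
      Rel M (Term.smul (c * c') a) (Term.smul c (Term.smul c' a))
  | one_smul {n p} (a : Term M n p) : Rel M (Term.smul 1 a) a
  | gen_add {n p} (x y : M.deg n p) :
      Rel M (Term.gen (x + y)) (Term.add (Term.gen x) (Term.gen y))
  | gen_smul {n p} (c : k) (x : M.deg n p) :
      Rel M (Term.gen (c • x)) (Term.smul c (Term.gen x))
  | gen_act {n p} (σ : Equiv.Perm (Fin n)) (x : M.deg n p) :
      Rel M (Term.gen ⟨M.act n σ x, M.act_mem n σ p x x.2⟩) (Term.act σ (Term.gen x))
  | act_add {n p} (σ : Equiv.Perm (Fin n)) (a b : Term M n p) :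
      Rel M (Term.act σ (Term.add a b)) (Term.add (Term.act σ a) (Term.act σ b))
  | act_smul {n p} (σ : Equiv.Perm (Fin n)) (c : k) (a : Term M n p) :
      Rel M (Term.act σ (Term.smul c a)) (Term.smul c (Term.act σ a))
  | act_one {n p} (a : Term M n p) : Rel M (Term.act 1 a) a
  | act_mul {n p} (σ τ : Equiv.Perm (Fin n)) (a : Term M n p) :
      Rel M (Term.act (σ * τ) a) (Term.act τ (Term.act σ a))
  | add_comp {l m n : ℕ} {p q r : ℤ} (h : n + 1 = l + m) (hr : p + q = r) (i : Fin l)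
      (a a' : Term M l p) (b : Term M m q) :
      Rel M (Term.comp h hr i (Term.add a a') b)
        (Term.add (Term.comp h hr i a b) (Term.comp h hr i a' b))
  | smul_comp {l m n : ℕ} {p q r : ℤ} (h : n + 1 = l + m) (hr : p + q = r) (i : Fin l)
      (c : k) (a : Term M l p) (b : Term M m q) :
      Rel M (Term.comp h hr i (Term.smul c a) b) (Term.smul c (Term.comp h hr i a b))
  | comp_add {l m n : ℕ} {p q r : ℤ} (h : n + 1 = l + m) (hr : p + q = r) (i : Fin l)
      (a : Term M l p) (b b' : Term M m q) :
      Rel M (Term.comp h hr i a (Term.add b b'))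
        (Term.add (Term.comp h hr i a b) (Term.comp h hr i a b'))
  | comp_smul {l m n : ℕ} {p q r : ℤ} (h : n + 1 = l + m) (hr : p + q = r) (i : Fin l)
      (c : k) (a : Term M l p) (b : Term M m q) :
      Rel M (Term.comp h hr i a (Term.smul c b)) (Term.smul c (Term.comp h hr i a b))
  | one_comp {n : ℕ} {p : ℤ} (h : n + 1 = 1 + n) (hr : 0 + p = p) (a : Term M n p) :
      Rel M (Term.comp h hr 0 Term.one a) a
  | comp_one {n : ℕ} {p : ℤ} (h : n + 1 = n + 1) (hr : p + 0 = p) (i : Fin n) (a : Term M n p) :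
      Rel M (Term.comp h hr i a Term.one) a
  | comp_assoc {l m n a b c : ℕ} {p q r pq qr t : ℤ} (hlm : a + 1 = l + m) (han : c + 1 = a + n)
      (hmn : b + 1 = m + n) (hlb : c + 1 = l + b) (hpq : p + q = pq) (hqr : q + r = qr)
      (ht : pq + r = t) (ht' : p + qr = t) (i : Fin l) (j : Fin m) (s : Fin a)
      (x : Term M l p) (y : Term M m q) (z : Term M n r) : s.1 = i.1 + j.1 →
      Rel M (Term.comp han ht s (Term.comp hlm hpq i x y) z)
        (Term.comp hlb ht' i x (Term.comp hmn hqr j y z))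
  | comp_comm {l m n a b c : ℕ} {p q r pq pr t : ℤ} (hlm : a + 1 = l + m) (han : c + 1 = a + n)
      (hln : b + 1 = l + n) (hbm : c + 1 = b + m) (hpq : p + q = pq) (hpr : p + r = pr)
      (ht : pq + r = t) (ht' : pr + q = t) (i j : Fin l) (s : Fin a) (t : Fin b)
      (x : Term M l p) (y : Term M m q) (z : Term M n r) : i < j → s.1 + 1 = j.1 + m → t.1 = i.1 →
      Rel M (Term.comp han ht s (Term.comp hlm hpq i x y) z)
        (Term.smul (((q * r).negOnePow : ℤ) : k)
          (Term.comp hbm ht' t (Term.comp hln hpr j x z) y))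
  | comp_act {l m n : ℕ} {p q r : ℤ} (h : n + 1 = l + m) (hr : p + q = r) (i : Fin l)
      (σ : Equiv.Perm (Fin l)) (τ : Equiv.Perm (Fin m)) (x : Term M l p) (y : Term M m q) :
      Rel M (Term.comp h hr i (Term.act σ x) (Term.act τ y))
        (Term.act (blockPerm h i σ τ) (Term.comp h hr (σ i) x y))

/-- Terms up to the laws of graded operads, as a setoid. -/
instance termSetoid (M : GradedSigmaModule k) (n : ℕ) (p : ℤ) : Setoid (Term M n p) where
  r := Rel M
  iseqv := ⟨Rel.refl, Rel.symm, Rel.trans⟩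

/-- The part of arity `n` and degree `p` of the free graded operad. -/
def Part (M : GradedSigmaModule k) (n : ℕ) (p : ℤ) : Type u :=
  Quotient (termSetoid M n p)

namespace Part

variable {M : GradedSigmaModule k} {n : ℕ} {p : ℤ}

/-- The class of a term. -/
def mk (a : Term M n p) : Part M n p :=
  Quotient.mk _ a

theorem mk_eq {a b : Term M n p} (h : Rel M a b) : mk a = mk b :=
  Quotient.sound h

theorem ind {C : Part M n p → Prop} (h : ∀ a, C (mk a)) (x : Part M n p) : C x :=
  Quotient.ind h x

instance : Zero (Part M n p) := ⟨mk Term.zero⟩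

instance : Add (Part M n p) :=
  ⟨Quotient.map₂ Term.add fun _ _ h _ _ h' => Rel.add_congr h h'⟩

instance : SMul k (Part M n p) :=
  ⟨fun c => Quotient.map (Term.smul c) fun _ _ h => Rel.smul_congr c h⟩

instance : Neg (Part M n p) := ⟨fun x => (-1 : k) • x⟩

theorem mk_add (a b : Term M n p) : mk (Term.add a b) = mk a + mk b := rfl

theorem mk_smul (c : k) (a : Term M n p) : mk (Term.smul c a) = c • mk a := rfl

theorem mk_zero : mk (Term.zero : Term M n p) = 0 := rfl

instance : AddCommGroup (Part M n p) where
  add_assoc x y z := by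
    induction x using ind; induction y using ind; induction z using ind
    exact mk_eq (Rel.add_assoc _ _ _)
  zero_add x := by
    induction x using ind
    exact mk_eq (Rel.zero_add _)
  add_zero x := by
    induction x using ind
    exact mk_eq (Rel.trans (Rel.add_comm _ _) (Rel.zero_add _))
  add_comm x y := by
    induction x using ind; induction y using ind
    exact mk_eq (Rel.add_comm _ _)
  neg_add_cancel x := by
    induction x using ind
    exact mk_eq (Rel.neg_add _)
  nsmul := nsmulRec
  zsmul := zsmulRec

instance : Module k (Part M n p) :=
  Module.ofMinimalAxioms
    (fun c x y => by
      induction x using ind; induction y using ind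
      exact mk_eq (Rel.smul_add _ _ _))
    (fun c c' x => by
      induction x using ind
      exact mk_eq (Rel.add_smul _ _ _))
    (fun c c' x => by
      induction x using ind
      exact mk_eq (Rel.mul_smul _ _ _))
    (fun x => by
      induction x using ind
      exact mk_eq (Rel.one_smul _))

/-- The generators. -/
def gen (M : GradedSigmaModule k) (n : ℕ) (p : ℤ) : M.deg n p →ₗ[k] Part M n p where
  toFun x := mk (Term.gen x)
  map_add' x y := mk_eq (Rel.gen_add x y)
  map_smul' c x := mk_eq (Rel.gen_smul c x)

/-- The action of the symmetric group. -/
def act (σ : Equiv.Perm (Fin n)) : Part M n p →ₗ[k] Part M n p where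
  toFun := Quotient.map (Term.act σ) fun _ _ h => Rel.act_congr σ h
  map_add' x y := by
    induction x using ind; induction y using ind
    exact mk_eq (Rel.act_add _ _ _)
  map_smul' c x := by
    induction x using ind
    exact mk_eq (Rel.act_smul _ _ _)

theorem act_mk (σ : Equiv.Perm (Fin n)) (a : Term M n p) : act σ (mk a) = mk (Term.act σ a) := rfl

/-- Partial composition. -/
def comp {l m n : ℕ} {p q r : ℤ} (h : n + 1 = l + m) (hr : p + q = r) (i : Fin l) :
    Part M l p →ₗ[k] Part M m q →ₗ[k] Part M n r :=
  LinearMap.mk₂ k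
    (Quotient.map₂ (Term.comp h hr i) fun _ _ ha _ _ hb => Rel.comp_congr h hr i ha hb)
    (fun x x' y => by
      induction x using ind; induction x' using ind; induction y using ind
      exact mk_eq (Rel.add_comp _ _ _ _ _ _))
    (fun c x y => by
      induction x using ind; induction y using ind
      exact mk_eq (Rel.smul_comp _ _ _ _ _ _))
    (fun x y y' => by
      induction x using ind; induction y using ind; induction y' using ind
      exact mk_eq (Rel.comp_add _ _ _ _ _ _))
    (fun c x y => by
      induction x using ind; induction y using ind
      exact mk_eq (Rel.comp_smul _ _ _ _ _ _))

theorem comp_mk {l m n : ℕ} {p q r : ℤ} (h : n + 1 = l + m) (hr : p + q = r) (i : Fin l)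
    (a : Term M l p) (b : Term M m q) : comp h hr i (mk a) (mk b) = mk (Term.comp h hr i a b) :=
  rfl

end Part

end FreeOperad

namespace FreeOperad

open DirectSum

variable {k : Type u} [Field k]

/-- The graded `Σ`-module underlying the free graded operad. -/
abbrev sigmaModule (M : GradedSigmaModule k) : GradedSigmaModule k :=
  GradedSigmaModule.ofHomogeneous (Part M) (fun _ _ σ => Part.act σ)
    (fun n p x => by
      induction x using Part.ind
      exact Part.mk_eq (Rel.act_one _))
    (fun n p σ τ x => by
      induction x using Part.ind
      exact Part.mk_eq (Rel.act_mul _ _ _))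

/-- The homogeneous element represented by a term. -/
def toObj (M : GradedSigmaModule k) {n : ℕ} (p : ℤ) : Part M n p →ₗ[k] (sigmaModule M).obj n :=
  lof k ℤ (Part M n) p

theorem toObj_mem (M : GradedSigmaModule k) {n : ℕ} {p : ℤ} (x : Part M n p) :
    toObj M p x ∈ (sigmaModule M).deg n p :=
  ⟨x, rfl⟩

theorem exists_term {M : GradedSigmaModule k} {n : ℕ} {p : ℤ} {x : (sigmaModule M).obj n}
    (hx : x ∈ (sigmaModule M).deg n p) : ∃ a : Term M n p, toObj M p (Part.mk a) = x := by
  obtain ⟨y, rfl⟩ := hx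
  induction y using Part.ind with
  | h a => exact ⟨a, rfl⟩

theorem act_toObj (M : GradedSigmaModule k) {n : ℕ} {p : ℤ} (σ : Equiv.Perm (Fin n))
    (x : Part M n p) : (sigmaModule M).act n σ (toObj M p x) = toObj M p (Part.act σ x) := by
  exact DirectSum.lmap_lof _ _ _

theorem smul_toObj (M : GradedSigmaModule k) {n : ℕ} {p : ℤ} (c : k) (x : Part M n p) :
    c • toObj M p x = toObj M p (c • x) :=
  (map_smul _ _ _).symm

/-- The extension of a family of bilinear maps on homogeneous parts to direct sums. -/
def bilinearExtension {A B C : ℤ → Type u} [∀ p, AddCommGroup (A p)] [∀ p, Module k (A p)]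
    [∀ p, AddCommGroup (B p)] [∀ p, Module k (B p)] [∀ p, AddCommGroup (C p)] [∀ p, Module k (C p)]
    (f : ∀ p q, A p →ₗ[k] B q →ₗ[k] C (p + q)) : (⨁ p, A p) →ₗ[k] (⨁ p, B p) →ₗ[k] ⨁ p, C p :=
  DirectSum.toModule k ℤ _ fun p => LinearMap.flip <| DirectSum.toModule k ℤ _ fun q =>
    LinearMap.flip <| (f p q).compr₂ (lof k ℤ C (p + q))

theorem bilinearExtension_lof {A B C : ℤ → Type u} [∀ p, AddCommGroup (A p)] [∀ p, Module k (A p)]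
    [∀ p, AddCommGroup (B p)] [∀ p, Module k (B p)] [∀ p, AddCommGroup (C p)] [∀ p, Module k (C p)]
    (f : ∀ p q, A p →ₗ[k] B q →ₗ[k] C (p + q)) {p q : ℤ} (x : A p) (y : B q) :
    bilinearExtension f (lof k ℤ A p x) (lof k ℤ B q y) = lof k ℤ C (p + q) (f p q x y) := by
  simp [bilinearExtension]

/-- Partial composition in the free graded operad. -/
def compObj (M : GradedSigmaModule k) {l m n : ℕ} (h : n + 1 = l + m) (i : Fin l) :
    (sigmaModule M).obj l →ₗ[k] (sigmaModule M).obj m →ₗ[k] (sigmaModule M).obj n :=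
  bilinearExtension fun _ _ => Part.comp h rfl i

theorem compObj_toObj (M : GradedSigmaModule k) {l m n : ℕ} {p q r : ℤ} (h : n + 1 = l + m)
    (hr : p + q = r) (i : Fin l) (x : Part M l p) (y : Part M m q) :
    compObj M h i (toObj M p x) (toObj M q y) = toObj M r (Part.comp h hr i x y) := by
  subst hr
  exact bilinearExtension_lof _ x y

/-- Koszul signs are units of `ℤ` in the operad laws but scalars of `k` in terms; this converts
between the two. -/
theorem units_intCast_smul {V : Type*} [AddCommGroup V] [Module k V] (ε : ℤˣ) (x : V) :
    ((ε : ℤ) : k) • x = ε • x := by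
  rw [Int.cast_smul_eq_zsmul, Units.smul_def]

end FreeOperad

open FreeOperad in
/-- The free graded operad `Γ(M)` on a graded `Σ`-module `M`. -/
def freeOperad {k : Type u} [Field k] (M : GradedSigmaModule k) : GradedOperad k where
  toGradedSigmaModule := sigmaModule M
  comp h i := compObj M h i
  comp_mem h i p q x y := by
    rintro ⟨x, rfl⟩ ⟨y, rfl⟩
    change compObj M h i (toObj M p x) (toObj M q y) ∈ _
    rw [compObj_toObj M h rfl]
    exact toObj_mem M _
  one := toObj M 0 (FreeOperad.Part.mk Term.one)
  one_mem := toObj_mem M _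
  one_comp h x := by
    -- The pattern for all the laws: both sides are linear in each argument, so homogeneous
    -- arguments suffice; these are classes of terms, for which the law is a constructor of `Rel`.
    -- In `comp_comm` the arguments `y` and `z` are homogeneous by hypothesis.
    induction x using (sigmaModule M).homogeneous_induction with
    | hom p x hx =>
      obtain ⟨a, rfl⟩ := exists_term hx
      rw [compObj_toObj M h (zero_add p), FreeOperad.Part.comp_mk, FreeOperad.Part.mk_eq (Rel.one_comp _ _ _)]
    | add x y hx hy => rw [map_add, hx, hy]
  comp_one h i x := by
    induction x using (sigmaModule M).homogeneous_induction with
    | hom p x hx =>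
      obtain ⟨a, rfl⟩ := exists_term hx
      rw [compObj_toObj M h (add_zero p), FreeOperad.Part.comp_mk, FreeOperad.Part.mk_eq (Rel.comp_one _ _ _ _)]
    | add x y hx hy => rw [map_add, LinearMap.add_apply, hx, hy]
  comp_assoc hlm han hmn hlb i j s x y z hs := by
    induction x using (sigmaModule M).homogeneous_induction with
    | add x x' hx hx' => simp only [map_add, LinearMap.add_apply, hx, hx']
    | hom p x hx =>
    induction y using (sigmaModule M).homogeneous_induction with
    | add y y' hy hy' => simp only [map_add, LinearMap.add_apply, hy, hy']
    | hom q y hy =>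
    induction z using (sigmaModule M).homogeneous_induction with
    | add z z' hz hz' => simp only [map_add, hz, hz']
    | hom r z hz =>
    obtain ⟨x, rfl⟩ := exists_term hx
    obtain ⟨y, rfl⟩ := exists_term hy
    obtain ⟨z, rfl⟩ := exists_term hz
    rw [compObj_toObj M _ rfl, compObj_toObj M _ rfl, compObj_toObj M _ rfl,
      compObj_toObj M _ (add_assoc p q r).symm]
    exact congrArg _ (FreeOperad.Part.mk_eq (Rel.comp_assoc _ _ _ _ _ _ _ _ _ _ _ _ _ _ hs))
  comp_comm hlm han hln hbm i j s t p q x y z hij hs ht hy hz := by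
    induction x using (sigmaModule M).homogeneous_induction with
    | add x x' hx hx' => simp only [map_add, LinearMap.add_apply, hx, hx', smul_add]
    | hom r x hx =>
    obtain ⟨x, rfl⟩ := exists_term hx
    obtain ⟨y, rfl⟩ := exists_term hy
    obtain ⟨z, rfl⟩ := exists_term hz
    have hd : r + q + p = r + p + q := by ring
    rw [compObj_toObj M _ rfl, compObj_toObj M _ rfl, compObj_toObj M _ rfl,
      compObj_toObj M _ hd, ← units_intCast_smul (k := k), smul_toObj]
    exact congrArg _ (FreeOperad.Part.mk_eq (Rel.comp_comm _ _ _ _ _ _ _ _ _ _ _ _ _ _ _ hij hs ht))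
  comp_act h i σ τ x y := by
    induction x using (sigmaModule M).homogeneous_induction with
    | add x x' hx hx' => simp only [map_add, LinearMap.add_apply, hx, hx']
    | hom p x hx =>
    induction y using (sigmaModule M).homogeneous_induction with
    | add y y' hy hy' => simp only [map_add, hy, hy']
    | hom q y hy =>
    obtain ⟨x, rfl⟩ := exists_term hx
    obtain ⟨y, rfl⟩ := exists_term hy
    rw [act_toObj, act_toObj, compObj_toObj M _ rfl, compObj_toObj M _ rfl, act_toObj]
    exact congrArg _ (FreeOperad.Part.mk_eq (Rel.comp_act _ _ _ _ _ _ _))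

namespace FreeOperad

variable {k : Type u} [Field k]

/-- The inclusion of a homogeneous part into the free operad. -/
def ofPart (M : GradedSigmaModule k) {n : ℕ} (p : ℤ) : Part M n p →ₗ[k] (freeOperad M).obj n :=
  toObj M p

theorem ofPart_mem (M : GradedSigmaModule k) {n : ℕ} {p : ℤ} (x : Part M n p) :
    ofPart M p x ∈ (freeOperad M).deg n p :=
  ⟨x, rfl⟩

theorem exists_term_of_mem {M : GradedSigmaModule k} {n : ℕ} {p : ℤ} {x : (freeOperad M).obj n}
    (hx : x ∈ (freeOperad M).deg n p) : ∃ a : Term M n p, ofPart M p (Part.mk a) = x :=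
  exists_term hx

theorem act_ofPart (M : GradedSigmaModule k) {n : ℕ} {p : ℤ} (σ : Equiv.Perm (Fin n))
    (x : Part M n p) : (freeOperad M).act n σ (ofPart M p x) = ofPart M p (Part.act σ x) :=
  act_toObj M σ x

theorem comp_ofPart (M : GradedSigmaModule k) {l m n : ℕ} {p q r : ℤ} (h : n + 1 = l + m)
    (hr : p + q = r) (i : Fin l) (x : Part M l p) (y : Part M m q) :
    (freeOperad M).comp h i (ofPart M p x) (ofPart M q y) = ofPart M r (Part.comp h hr i x y) :=
  compObj_toObj M h hr i x y

/-- The inclusion of the generators into the free operad. -/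
noncomputable def of (M : GradedSigmaModule k) :
    GradedSigmaModule.Hom M (freeOperad M).toGradedSigmaModule where
  app n := M.ofDegrees fun p => (ofPart M p) ∘ₗ Part.gen M n p
  app_mem n p x hx := by
    rw [M.ofDegrees_apply _ ⟨x, hx⟩]
    exact ofPart_mem M _
  app_act n σ x := by
    induction x using M.homogeneous_induction with
    | hom p x hx =>
      rw [M.ofDegrees_apply _ ⟨x, hx⟩, M.ofDegrees_apply _ ⟨_, M.act_mem n σ p x hx⟩]
      exact (congrArg (ofPart M p) (Part.mk_eq (Rel.gen_act σ ⟨x, hx⟩))).trans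
        (act_ofPart M σ (Part.mk (Term.gen ⟨x, hx⟩))).symm
    | add x y hx hy => simp only [map_add, hx, hy]

theorem of_apply (M : GradedSigmaModule k) {n : ℕ} {p : ℤ} (x : M.deg n p) :
    (of M).app n x = ofPart M p (Part.mk (Term.gen x)) :=
  M.ofDegrees_apply _ x

/-- Induction on elements of the free operad, for predicates that are linear. -/
theorem induction {M : GradedSigmaModule k} {C : ∀ n, (freeOperad M).obj n → Prop}
    (add : ∀ n x y, C n x → C n y → C n (x + y)) (smul : ∀ n (c : k) x, C n x → C n (c • x))
    (of : ∀ n p x, x ∈ M.deg n p → C n ((of M).app n x)) (one : C 1 (freeOperad M).one)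
    (comp : ∀ (l m n : ℕ) (h : n + 1 = l + m) (i : Fin l) (p q : ℤ) (x : (freeOperad M).obj l)
      (y : (freeOperad M).obj m), x ∈ (freeOperad M).deg l p → y ∈ (freeOperad M).deg m q →
      C l x → C m y → C n ((freeOperad M).comp h i x y))
    (act : ∀ n σ x, C n x → C n ((freeOperad M).act n σ x)) (n : ℕ) (x : (freeOperad M).obj n) :
    C n x := by
  have key : ∀ (n : ℕ) (p : ℤ) (a : Term M n p), C n (ofPart M p (Part.mk a)) := by
    intro n p a
    induction a with
    | gen x => exact of_apply M x ▸ of _ _ _ x.2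
    | one => exact one
    | comp h hr i a b ha hb =>
      rw [← Part.comp_mk, ← comp_ofPart]
      exact comp _ _ _ h i _ _ _ _ (ofPart_mem M _) (ofPart_mem M _) ha hb
    | act σ a ha =>
      rw [← Part.act_mk, ← act_ofPart]
      exact act _ _ _ ha
    | zero =>
      rw [Part.mk_zero, map_zero]
      rename_i n p
      -- Zero is the image of the zero generator, so the induction principle needs no separate case
      -- for it.
      have := of n p 0 (Submodule.zero_mem _)
      rw [map_zero] at this
      exact this
    | add a b ha hb =>
      rw [Part.mk_add, map_add]
      exact add _ _ _ ha hb
    | smul c a ha =>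
      rw [Part.mk_smul, map_smul]
      exact smul _ _ _ ha
  induction x using (freeOperad M).homogeneous_induction with
  | hom p x hx =>
    obtain ⟨a, rfl⟩ := exists_term_of_mem hx
    exact key n p a
  | add x y hx hy => exact add _ _ _ hx hy

/-! ### The universal property of the free operad -/

/-- The value of a term in an operad. -/
def Term.eval {M : GradedSigmaModule k} {Q : GradedOperad k}
    (f : GradedSigmaModule.Hom M Q.toGradedSigmaModule) : ∀ {n : ℕ} {p : ℤ}, Term M n p → Q.obj n
  | _, _, .gen x => f.app _ x
  | _, _, .one => Q.one
  | _, _, .comp h _ i a b => Q.comp h i (a.eval f) (b.eval f)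
  | _, _, .act σ a => Q.act _ σ (a.eval f)
  | _, _, .zero => 0
  | _, _, .add a b => a.eval f + b.eval f
  | _, _, .smul c a => c • a.eval f

section Lift

variable {M : GradedSigmaModule k} {Q : GradedOperad k}
  (f : GradedSigmaModule.Hom M Q.toGradedSigmaModule)

theorem Term.eval_mem {n : ℕ} {p : ℤ} (a : Term M n p) : a.eval f ∈ Q.deg n p := by
  induction a with
  | gen x => exact f.app_mem _ _ _ x.2
  | one => exact Q.one_mem
  | comp h hr i a b ha hb => exact hr ▸ Q.comp_mem h i _ _ _ _ ha hb
  | act σ a ha => exact Q.act_mem _ _ _ _ ha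
  | zero => exact Submodule.zero_mem _
  | add a b ha hb => exact Submodule.add_mem _ ha hb
  | smul c a ha => exact Submodule.smul_mem _ _ ha

/-- Each generating relation is a law valid in every graded operad. Parallel associativity carries a
sign, hence needs homogeneous values, which `Term.eval_mem` supplies. -/
theorem Rel.eval_eq {n : ℕ} {p : ℤ} {a b : Term M n p} (h : Rel M a b) : a.eval f = b.eval f := by
  induction h with
  | refl => rfl
  | symm _ ih => exact ih.symm
  | trans _ _ ih ih' => exact ih.trans ih'
  | comp_congr h hr i _ _ ih ih' => simp only [Term.eval, ih, ih']
  | act_congr σ _ ih => simp only [Term.eval, ih]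
  | add_congr _ _ ih ih' => simp only [Term.eval, ih, ih']
  | smul_congr c _ ih => simp only [Term.eval, ih]
  | add_assoc => exact _root_.add_assoc _ _ _
  | add_comm => exact _root_.add_comm _ _
  | zero_add => exact _root_.zero_add _
  | neg_add => simp [Term.eval]
  | smul_add => exact _root_.smul_add _ _ _
  | add_smul => exact _root_.add_smul _ _ _
  | mul_smul => exact SemigroupAction.mul_smul _ _ _
  | one_smul => exact _root_.one_smul _ _
  | gen_add => simp [Term.eval]
  | gen_smul => simp [Term.eval]
  | gen_act σ x => exact f.app_act _ _ _
  | act_add => simp [Term.eval]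
  | act_smul => simp [Term.eval]
  | act_one => exact Q.act_one _ _
  | act_mul => exact Q.act_mul _ _ _ _
  | add_comp => simp [Term.eval]
  | smul_comp => simp [Term.eval]
  | comp_add => simp [Term.eval]
  | comp_smul => simp [Term.eval]
  | one_comp => exact Q.one_comp _ _
  | comp_one => exact Q.comp_one _ _ _
  | comp_assoc _ _ _ _ _ _ _ _ _ _ _ _ _ _ hs => exact Q.comp_assoc _ _ _ _ _ _ _ _ _ _ hs
  | comp_comm _ _ _ _ _ _ _ _ _ _ _ _ x y z hij hs ht =>
    simp only [Term.eval, units_intCast_smul]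
    exact Q.comp_comm _ _ _ _ _ _ _ _ _ _ _ _ _ hij hs ht (y.eval_mem f) (z.eval_mem f)
  | comp_act => exact Q.comp_act _ _ _ _ _ _

/-- The value of a homogeneous element of the free operad in an operad. -/
def Part.eval {n : ℕ} {p : ℤ} : Part M n p →ₗ[k] Q.obj n where
  toFun := Quotient.lift (fun a => a.eval f) fun _ _ h => Rel.eval_eq f h
  map_add' x y := by
    induction x using Part.ind; induction y using Part.ind
    rfl
  map_smul' c x := by
    induction x using Part.ind
    rfl

/-- The linear maps underlying `lift`. -/
def liftApp (n : ℕ) : (freeOperad M).obj n →ₗ[k] Q.obj n :=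
  DirectSum.toModule k ℤ (Q.obj n) fun p => (Part.eval f : Part M n p →ₗ[k] Q.obj n)

theorem liftApp_ofPart {n : ℕ} {p : ℤ} (a : Term M n p) :
    liftApp f n (ofPart M p (Part.mk a)) = a.eval f := by
  exact DirectSum.toModule_lof k p (Part.mk a)

/-- The morphism from the free operad that extends a morphism of graded `Σ`-modules. -/
def lift : GradedOperad.Hom (freeOperad M) Q where
  app := liftApp f
  app_mem n p x hx := by
    obtain ⟨a, rfl⟩ := exists_term_of_mem hx
    rw [liftApp_ofPart]
    exact a.eval_mem f
  app_act n σ x := by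
    induction x using (freeOperad M).homogeneous_induction with
    | hom p x hx =>
      obtain ⟨a, rfl⟩ := exists_term_of_mem hx
      rw [act_ofPart, Part.act_mk, liftApp_ofPart, liftApp_ofPart]
      rfl
    | add x y hx hy => simp only [map_add, hx, hy]
  app_one := liftApp_ofPart f _
  app_comp h i x y := by
    induction x using (freeOperad M).homogeneous_induction with
    | add x x' hx hx' => simp only [map_add, LinearMap.add_apply, hx, hx']
    | hom p x hx =>
    induction y using (freeOperad M).homogeneous_induction with
    | add y y' hy hy' => simp only [map_add, hy, hy']
    | hom q y hy =>
    obtain ⟨x, rfl⟩ := exists_term_of_mem hx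
    obtain ⟨y, rfl⟩ := exists_term_of_mem hy
    rw [comp_ofPart M h rfl, Part.comp_mk, liftApp_ofPart, liftApp_ofPart, liftApp_ofPart]
    rfl

theorem lift_of {n : ℕ} (x : M.obj n) : (lift f).app n ((of M).app n x) = f.app n x := by
  induction x using M.homogeneous_induction with
  | hom p x hx =>
    have := of_apply M ⟨x, hx⟩
    rw [this]
    exact liftApp_ofPart f _
  | add x y hx hy => simp only [map_add, hx, hy]

theorem app_eq {g g' : GradedOperad.Hom (freeOperad M) Q}
    (h : ∀ n x, g.app n ((of M).app n x) = g'.app n ((of M).app n x)) (n : ℕ)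
    (x : (freeOperad M).obj n) : g.app n x = g'.app n x := by
  induction n, x using FreeOperad.induction with
  | add n x y hx hy => rw [map_add, map_add, hx, hy]
  | smul n c x hx => rw [map_smul, map_smul, hx]
  | of n p x _ => exact h n x
  | one => rw [g.app_one, g'.app_one]
  | comp l m n h i p q x y _ _ hx hy => rw [g.app_comp, g'.app_comp, hx, hy]
  | act n σ x hx => rw [g.app_act, g'.app_act, hx]

theorem hom_ext {g g' : GradedOperad.Hom (freeOperad M) Q}
    (h : ∀ n x, g.app n ((of M).app n x) = g'.app n ((of M).app n x)) : g = g' :=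
  GradedOperad.Hom.ext (funext fun n => LinearMap.ext fun x => app_eq h n x)

end Lift

theorem isFreeOn_of (M : GradedSigmaModule k) : GradedOperad.IsFreeOn (of M) := by
  intro Q f
  refine ⟨lift f, ?_, fun g hg => hom_ext fun n x => ?_⟩
  · exact GradedSigmaModule.Hom.ext (funext fun n => LinearMap.ext fun x => lift_of f x)
  · rw [lift_of, ← hg]
    rfl

end FreeOperad

/-! ### Derivations of free operads and free dg operads -/

/-- Equivariant maps of degree `1` of graded `Σ`-modules. -/
@[ext]
structure GradedSigmaModule.ShiftHom {k : Type u} [Field k] (M N : GradedSigmaModule k) where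
  app : ∀ n, M.obj n →ₗ[k] N.obj n
  app_mem : ∀ n p x, x ∈ M.deg n p → app n x ∈ N.deg n (p + 1)
  app_act : ∀ n σ x, app n (M.act n σ x) = N.act n σ (app n x)

/-- Derivations of degree `1` of a graded operad. -/
structure GradedOperad.Derivation {k : Type u} [Field k] (Q : GradedOperad k) extends
    GradedSigmaModule.ShiftHom Q.toGradedSigmaModule Q.toGradedSigmaModule where
  app_comp : ∀ {l m n : ℕ} (h : n + 1 = l + m) (i : Fin l) (p : ℤ) (x : Q.obj l) (y : Q.obj m),
    x ∈ Q.deg l p → app n (Q.comp h i x y) =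
      Q.comp h i (app l x) y + p.negOnePow • Q.comp h i x (app m y)

/-- The Leibniz rule for `1 ∘ 1 = 1` reads `D1 = D1 + D1`. -/
theorem GradedOperad.Derivation.app_one {k : Type u} [Field k] {Q : GradedOperad k}
    (D : Q.Derivation) : D.app 1 Q.one = 0 := by
  have h := D.app_comp (l := 1) (m := 1) (n := 1) rfl 0 0 Q.one Q.one Q.one_mem
  rw [Q.one_comp, Q.comp_one, Q.one_comp] at h
  simpa using h

/-- The differential of a dg operad, as a derivation. -/
def DGOperad.derivation {k : Type u} [Field k] (P : DGOperad k) : P.toGradedOperad.Derivation where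
  app := P.diff
  app_mem := P.diff_mem
  app_act := P.diff_act
  app_comp := P.diff_comp

namespace FreeOperad

variable {k : Type u} [Field k] {M : GradedSigmaModule k}

section Derivation

variable (d : GradedSigmaModule.ShiftHom M (freeOperad M).toGradedSigmaModule)

/-- The element of the free operad represented by a term. -/
def Term.toFree {n : ℕ} {p : ℤ} (a : Term M n p) : (freeOperad M).obj n :=
  ofPart M p (Part.mk a)

theorem Term.toFree_mem {n : ℕ} {p : ℤ} (a : Term M n p) : a.toFree ∈ (freeOperad M).deg n p :=
  ofPart_mem M _

theorem Term.toFree_comp {l m n : ℕ} {p q r : ℤ} (h : n + 1 = l + m) (hr : p + q = r) (i : Fin l)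
    (a : Term M l p) (b : Term M m q) :
    (Term.comp h hr i a b).toFree = (freeOperad M).comp h i a.toFree b.toFree :=
  (comp_ofPart M h hr i (Part.mk a) (Part.mk b)).symm

theorem Term.toFree_act {n : ℕ} {p : ℤ} (σ : Equiv.Perm (Fin n)) (a : Term M n p) :
    (Term.act σ a).toFree = (freeOperad M).act n σ a.toFree :=
  (act_ofPart M σ (Part.mk a)).symm

theorem Term.toFree_add {n : ℕ} {p : ℤ} (a b : Term M n p) :
    (Term.add a b).toFree = a.toFree + b.toFree :=
  map_add (ofPart M p) (Part.mk a) (Part.mk b)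

theorem Term.toFree_smul {n : ℕ} {p : ℤ} (c : k) (a : Term M n p) :
    (Term.smul c a).toFree = c • a.toFree :=
  map_smul (ofPart M p) c (Part.mk a)

theorem Term.toFree_one : (Term.one : Term M 1 0).toFree = (freeOperad M).one :=
  rfl

theorem Rel.toFree_eq {n : ℕ} {p : ℤ} {a b : Term M n p} (h : Rel M a b) : a.toFree = b.toFree :=
  congrArg (ofPart M p) (Part.mk_eq h)

/-- The value on terms of the derivation extending `d`. -/
def Term.deriv : ∀ {n : ℕ} {p : ℤ}, Term M n p → (freeOperad M).obj n
  | _, _, .gen x => d.app _ x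
  | _, _, .one => 0
  | _, _, .comp (p := p) h _ i a b =>
    (freeOperad M).comp h i (a.deriv) b.toFree +
      p.negOnePow • (freeOperad M).comp h i a.toFree (b.deriv)
  | _, _, .act σ a => (freeOperad M).act _ σ (a.deriv)
  | _, _, .zero => 0
  | _, _, .add a b => a.deriv + b.deriv
  | _, _, .smul c a => c • a.deriv

theorem Term.deriv_mem {n : ℕ} {p : ℤ} (a : Term M n p) :
    a.deriv d ∈ (freeOperad M).deg n (p + 1) := by
  induction a with
  | gen x => exact d.app_mem _ _ _ x.2
  | one => exact Submodule.zero_mem _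
  | @comp l m n p q r h hr i a b ha hb =>
    refine Submodule.add_mem _ ?_ ?_
    · have := (freeOperad M).comp_mem h i _ _ _ _ ha b.toFree_mem
      rwa [add_right_comm, hr] at this
    · have := (freeOperad M).comp_mem h i _ _ _ _ a.toFree_mem hb
      rw [← add_assoc, hr] at this
      rw [← units_intCast_smul (k := k)]
      exact Submodule.smul_mem _ _ this
  | act σ a ha => exact (freeOperad M).act_mem _ _ _ _ ha
  | zero => exact Submodule.zero_mem _
  | add a b ha hb => exact Submodule.add_mem _ ha hb
  | smul c a ha => exact Submodule.smul_mem _ _ ha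

theorem map_units_smul {V W : Type*} [AddCommGroup V] [Module k V] [AddCommGroup W] [Module k W]
    (f : V →ₗ[k] W) (ε : ℤˣ) (x : V) : f (ε • x) = ε • f x := by
  rw [Units.smul_def, Units.smul_def, map_zsmul]

theorem smul_units_smul {V : Type*} [AddCommGroup V] [Module k V] (ε : ℤˣ) (c : k) (x : V) :
    c • ε • x = ε • c • x := by
  rw [Units.smul_def, Units.smul_def, smul_comm]

theorem units_smul_apply {V W : Type*} [AddCommGroup V] [Module k V] [AddCommGroup W] [Module k W]
    (f : V →ₗ[k] W) (ε : ℤˣ) (x : V) : (ε • f) x = ε • f x := by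
  rw [Units.smul_def, Units.smul_def, LinearMap.smul_apply]

/-- This makes the formal derivative descend to the free operad. Most relations are settled by
linearity and equivariance; sequential and parallel associativity are the ones that need a
comparison of signs among three Leibniz terms. -/
theorem Rel.deriv_eq {n : ℕ} {p : ℤ} {a b : Term M n p} (h : Rel M a b) :
    a.deriv d = b.deriv d := by
  induction h with
  | refl => rfl
  | symm _ ih => exact ih.symm
  | trans _ _ ih ih' => exact ih.trans ih'
  | comp_congr h hr i h1 h2 ih ih' =>
    simp only [Term.deriv, ih, ih', h1.toFree_eq, h2.toFree_eq]
  | act_congr σ _ ih => simp only [Term.deriv, ih]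
  | add_congr _ _ ih ih' => simp only [Term.deriv, ih, ih']
  | smul_congr c _ ih => simp only [Term.deriv, ih]
  | add_assoc => exact _root_.add_assoc _ _ _
  | add_comm => exact _root_.add_comm _ _
  | zero_add => exact _root_.zero_add _
  | neg_add => simp [Term.deriv]
  | smul_add => exact _root_.smul_add _ _ _
  | add_smul => exact _root_.add_smul _ _ _
  | mul_smul => exact SemigroupAction.mul_smul _ _ _
  | one_smul => exact _root_.one_smul _ _
  | gen_add => simp [Term.deriv]
  | gen_smul => simp [Term.deriv]
  | gen_act σ x => exact d.app_act _ _ _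
  | act_add => simp [Term.deriv]
  | act_smul => simp [Term.deriv]
  | act_one => exact (freeOperad M).act_one _ _
  | act_mul => exact (freeOperad M).act_mul _ _ _ _
  | add_comp =>
    simp only [Term.deriv, Term.toFree_add, map_add, LinearMap.add_apply, _root_.smul_add]
    abel
  | smul_comp =>
    simp only [Term.deriv, Term.toFree_smul, map_smul, LinearMap.smul_apply, _root_.smul_add,
      smul_units_smul]
  | comp_add =>
    simp only [Term.deriv, Term.toFree_add, map_add, _root_.smul_add]
    abel
  | comp_smul =>
    simp only [Term.deriv, Term.toFree_smul, map_smul, _root_.smul_add, smul_units_smul]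
  | one_comp h hr a =>
    simp [Term.deriv, Term.toFree_one, (freeOperad M).one_comp]
  | comp_one h hr i a =>
    simp [Term.deriv, Term.toFree_one, (freeOperad M).comp_one]
  | @comp_assoc l m n a b c p q r pq qr t hlm han hmn hlb hpq hqr ht ht' i j s x y z hs =>
    simp only [Term.deriv, Term.toFree_comp, map_add, LinearMap.add_apply, _root_.smul_add,
      map_units_smul, units_smul_apply, smul_smul, ← Int.negOnePow_add, hpq]
    rw [(freeOperad M).comp_assoc hlm han hmn hlb i j s _ _ _ hs,
      (freeOperad M).comp_assoc hlm han hmn hlb i j s _ _ _ hs,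
      (freeOperad M).comp_assoc hlm han hmn hlb i j s _ _ _ hs, _root_.add_assoc]
  | @comp_comm l m n a b c p q r pq pr t hlm han hln hbm hpq hpr ht ht' i j s t x y z hij hs hst =>
    simp only [Term.deriv, Term.toFree_comp, map_add, LinearMap.add_apply, _root_.smul_add,
      map_units_smul, units_smul_apply, smul_smul, units_intCast_smul]
    rw [(freeOperad M).comp_comm hlm han hln hbm i j s t q r _ _ _ hij hs hst y.toFree_mem
        z.toFree_mem,
      (freeOperad M).comp_comm hlm han hln hbm i j s t (q + 1) r _ _ _ hij hs hst (y.deriv_mem d)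
        z.toFree_mem,
      (freeOperad M).comp_comm hlm han hln hbm i j s t q (r + 1) _ _ _ hij hs hst y.toFree_mem
        (z.deriv_mem d)]
    simp only [smul_smul, ← Int.negOnePow_add]
    -- The term with `dy`: raising the degree of `y` changes the exchange sign by `r`, which matches
    -- the passage of the derivation over `x ∘ z`, of degree `p + r`.
    have e1 : (p + (q + 1) * r).negOnePow = (q * r + pr).negOnePow := by
      rw [← hpr]
      congr 1
      ring
    -- The term with `dz`: the exponents differ by `2q`, once from passing `y` and once from the
    -- exchange of `y` with `dz`.
    have e2 : (pq + q * (r + 1)).negOnePow = (q * r + p).negOnePow := by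
      rw [← hpq, Int.negOnePow_eq_iff]
      exact ⟨q, by ring⟩
    rw [e1, e2, _root_.add_assoc, _root_.add_comm _ ((q * r + p).negOnePow • _), _root_.add_assoc]
  | comp_act h hr i σ τ x y =>
    simp only [Term.deriv, Term.toFree_act, (freeOperad M).comp_act, map_add,
      map_units_smul]

/-- The value on homogeneous parts of the derivation extending `d`. -/
def Part.deriv {n : ℕ} {p : ℤ} : Part M n p →ₗ[k] (freeOperad M).obj n where
  toFun := Quotient.lift (fun a => a.deriv d) fun _ _ h => Rel.deriv_eq d h
  map_add' x y := by
    induction x using Part.ind; induction y using Part.ind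
    rfl
  map_smul' c x := by
    induction x using Part.ind
    rfl

/-- The linear maps underlying `derivation`. -/
def derivApp (n : ℕ) : (freeOperad M).obj n →ₗ[k] (freeOperad M).obj n :=
  DirectSum.toModule k ℤ ((freeOperad M).obj n) fun p =>
    (Part.deriv d : Part M n p →ₗ[k] (freeOperad M).obj n)

theorem derivApp_toFree {n : ℕ} {p : ℤ} (a : Term M n p) :
    derivApp d n a.toFree = a.deriv d := by
  exact DirectSum.toModule_lof k p (Part.mk a)

theorem exists_toFree_eq {n : ℕ} {p : ℤ} {x : (freeOperad M).obj n}
    (hx : x ∈ (freeOperad M).deg n p) : ∃ a : Term M n p, a.toFree = x :=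
  exists_term_of_mem hx

/-- The derivation of the free operad that extends `d`. -/
def derivation : (freeOperad M).Derivation where
  app := derivApp d
  app_mem n p x hx := by
    obtain ⟨a, rfl⟩ := exists_toFree_eq hx
    rw [derivApp_toFree]
    exact a.deriv_mem d
  app_act n σ x := by
    induction x using (freeOperad M).homogeneous_induction with
    | hom p x hx =>
      obtain ⟨a, rfl⟩ := exists_toFree_eq hx
      rw [← Term.toFree_act, derivApp_toFree, derivApp_toFree]
      rfl
    | add x y hx hy => simp only [map_add, hx, hy]
  app_comp h i p x y hx := by
    induction y using (freeOperad M).homogeneous_induction with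
    | add y y' hy hy' =>
      simp only [map_add, hy, hy', smul_add]
      abel
    | hom q y hy =>
    obtain ⟨x, rfl⟩ := exists_toFree_eq hx
    obtain ⟨y, rfl⟩ := exists_toFree_eq hy
    rw [← Term.toFree_comp h rfl, derivApp_toFree, derivApp_toFree, derivApp_toFree]
    rfl

theorem derivation_of {n : ℕ} (x : M.obj n) :
    (derivation d).app n ((of M).app n x) = d.app n x := by
  induction x using M.homogeneous_induction with
  | hom p x hx =>
    have := of_apply M ⟨x, hx⟩
    rw [this]
    exact derivApp_toFree d _
  | add x y hx hy => simp only [map_add, hx, hy]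

end Derivation

/-- A morphism from a free operad commutes with derivations if it does so on generators. -/
theorem app_derivation {Q : GradedOperad k} (D : (freeOperad M).Derivation) (D' : Q.Derivation)
    (g : GradedOperad.Hom (freeOperad M) Q)
    (h : ∀ n x, g.app n (D.app n ((of M).app n x)) = D'.app n (g.app n ((of M).app n x))) (n : ℕ)
    (x : (freeOperad M).obj n) : g.app n (D.app n x) = D'.app n (g.app n x) := by
  induction n, x using FreeOperad.induction with
  | add n x y hx hy => simp only [map_add, hx, hy]
  | smul n c x hx => simp only [map_smul, hx]
  | of n p x _ => exact h n x
  | one => rw [D.app_one, g.app_one, D'.app_one, map_zero]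
  | comp l m n h i p q x y hpx hpy hx hy =>
    rw [g.app_comp, D.app_comp h i p x y hpx, D'.app_comp h i p _ _ (g.app_mem _ _ _ hpx), map_add,
      map_units_smul, g.app_comp, g.app_comp, hx, hy]
  | act n σ x hx => rw [D.app_act, g.app_act, g.app_act, D'.app_act, hx]

/-- A derivation of a free operad squares to zero if it does so on generators. -/
theorem derivation_derivation (D : (freeOperad M).Derivation)
    (h : ∀ n x, D.app n (D.app n ((of M).app n x)) = 0) (n : ℕ) (x : (freeOperad M).obj n) :
    D.app n (D.app n x) = 0 := by
  induction n, x using FreeOperad.induction with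
  | add n x y hx hy => simp only [map_add, hx, hy, add_zero]
  | smul n c x hx => simp only [map_smul, hx, smul_zero]
  | of n p x _ => exact h n x
  | one => rw [D.app_one, map_zero]
  | comp l m n h i p q x y hpx hpy hx hy =>
    rw [D.app_comp h i p x y hpx, map_add, map_units_smul,
      D.app_comp h i (p + 1) _ y (D.app_mem _ _ _ hpx), D.app_comp h i p x _ hpx, hx, hy]
    -- The two cross terms `Dx ∘ Dy` have signs `(-1)^(p+1)` and `(-1)^p` and cancel.
    simp [Int.negOnePow_succ]
  | act n σ x hx => rw [D.app_act, D.app_act, hx, map_zero]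

/-- The dg operad on a free graded operad with the differential extending `d`. -/
@[reducible] def dgOperad (d : GradedSigmaModule.ShiftHom M (freeOperad M).toGradedSigmaModule)
    (hd : ∀ n x, (derivation d).app n (d.app n x) = 0) : DGOperad k where
  toGradedOperad := freeOperad M
  diff := (derivation d).app
  diff_mem := (derivation d).app_mem
  diff_diff := derivation_derivation (derivation d) fun n x => by rw [derivation_of, hd]
  diff_act := (derivation d).app_act
  diff_comp := (derivation d).app_comp

/-! ### Low arities -/

theorem eq_zero_of_arity_zero (h0 : Subsingleton (M.obj 0)) (x : (freeOperad M).obj 0) :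
    x = 0 := by
  suffices H : ∀ n (x : (freeOperad M).obj n), n = 0 → x = 0 from H 0 x rfl
  intro n x
  induction n, x using FreeOperad.induction with
  | add n x y hx hy => intro hn; rw [hx hn, hy hn, add_zero]
  | smul n c x hx => intro hn; rw [hx hn, smul_zero]
  | of n p x _ =>
    rintro rfl
    rw [Subsingleton.elim x 0, map_zero]
  | one => intro hn; omega
  | comp l m n h i p q x y _ _ hx hy =>
    intro hn
    -- The outer operation has an input `i`, so `l ≥ 1` and total arity zero forces `m = 0`.
    rw [hy (by have := i.2; omega), map_zero]
  | act n σ x hx => intro hn; rw [hx hn, map_zero]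

theorem exists_smul_one (h0 : Subsingleton (M.obj 0)) (h1 : Subsingleton (M.obj 1))
    (x : (freeOperad M).obj 1) : ∃ c : k, x = c • (freeOperad M).one := by
  suffices H : ∀ n (x : (freeOperad M).obj n) (hn : n = 1), ∃ c : k,
      x = c • (hn ▸ (freeOperad M).one) from H 1 x rfl
  intro n x
  induction n, x using FreeOperad.induction with
  | add n x y hx hy =>
    intro hn
    obtain ⟨c, hc⟩ := hx hn
    obtain ⟨c', hc'⟩ := hy hn
    exact ⟨c + c', by rw [add_smul, ← hc, ← hc']⟩
  | smul n c x hx =>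
    intro hn
    obtain ⟨c', hc'⟩ := hx hn
    exact ⟨c * c', by rw [mul_smul, ← hc']⟩
  | of n p x _ =>
    rintro rfl
    exact ⟨0, by rw [Subsingleton.elim x 0, map_zero, zero_smul]⟩
  | one => exact fun _ => ⟨1, (one_smul _ _).symm⟩
  | comp l m n h i p q x y _ _ hx hy =>
    rintro rfl
    have hl := i.2
    rcases Nat.eq_zero_or_pos m with rfl | hm
    · exact ⟨0, by rw [eq_zero_of_arity_zero h0 y, map_zero, zero_smul]⟩
    · obtain rfl : l = 1 := by omega
      obtain rfl : m = 1 := by omega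
      obtain ⟨c, rfl⟩ := hx rfl
      obtain ⟨c', rfl⟩ := hy rfl
      refine ⟨c * c', ?_⟩
      simp only [map_smul, LinearMap.smul_apply, (freeOperad M).comp_one, mul_smul]
      rw [smul_comm]
  | act n σ x hx =>
    rintro rfl
    obtain ⟨c, hc⟩ := hx rfl
    exact ⟨c, by rw [← hc, Subsingleton.elim σ 1, (freeOperad M).act_one]⟩

/-- The free operad in arity at most `t` is spanned by a suboperad containing the generators of
arity less than `t`, together with the generators of arity `t`. -/
theorem eq_app_add_of {Q : GradedOperad k} (g : GradedOperad.Hom Q (freeOperad M)) (t : ℕ)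
    (h0 : Subsingleton (M.obj 0)) (h1 : Subsingleton (M.obj 1))
    (hlt : ∀ n, n < t → ∀ x, ∃ y, (of M).app n x = g.app n y) :
    ∀ x : (freeOperad M).obj t, ∃ y e, x = g.app t y + (of M).app t e := by
  -- The two claims are proved together: composites in arity `t` are handled by the first claim for
  -- their factors, which have arity below `t` unless one of them is a multiple of the unit.
  suffices H : ∀ n (x : (freeOperad M).obj n), (n < t → ∃ y, x = g.app n y) ∧
      (n = t → ∃ y e, x = g.app n y + (of M).app n e) from fun x => (H t x).2 rfl
  intro n x
  induction n, x using FreeOperad.induction with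
  | add n x y hx hy =>
    refine ⟨fun hn => ?_, fun hn => ?_⟩
    · obtain ⟨a, rfl⟩ := hx.1 hn
      obtain ⟨b, rfl⟩ := hy.1 hn
      exact ⟨a + b, (map_add _ _ _).symm⟩
    · obtain ⟨a, e, rfl⟩ := hx.2 hn
      obtain ⟨b, e', rfl⟩ := hy.2 hn
      exact ⟨a + b, e + e', by simp only [map_add]; abel⟩
  | smul n c x hx =>
    refine ⟨fun hn => ?_, fun hn => ?_⟩
    · obtain ⟨a, rfl⟩ := hx.1 hn
      exact ⟨c • a, (map_smul _ _ _).symm⟩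
    · obtain ⟨a, e, rfl⟩ := hx.2 hn
      exact ⟨c • a, c • e, by simp only [map_smul, smul_add]⟩
  | of n p x _ =>
    exact ⟨fun hn => hlt n hn x, fun _ => ⟨0, x, by rw [map_zero, zero_add]⟩⟩
  | one =>
    exact ⟨fun _ => ⟨Q.one, g.app_one.symm⟩,
      fun _ => ⟨Q.one, 0, by rw [map_zero, add_zero, g.app_one]⟩⟩
  | comp l m n h i p q x y _ _ hx hy =>
    have hl := i.2
    rcases Nat.eq_zero_or_pos m with rfl | hm
    · rw [eq_zero_of_arity_zero h0 y, map_zero]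
      exact ⟨fun _ => ⟨0, (map_zero _).symm⟩, fun _ => ⟨0, 0, by simp⟩⟩
    refine ⟨fun hn => ?_, fun hn => ?_⟩
    · obtain ⟨a, rfl⟩ := hx.1 (by omega)
      obtain ⟨b, rfl⟩ := hy.1 (by omega)
      exact ⟨_, (g.app_comp h i a b).symm⟩
    -- A factor of arity one is a scalar multiple of the unit, so such a composite is a multiple of
    -- its other factor.
    · by_cases hl1 : l = 1
      · subst hl1
        obtain rfl : m = n := by omega
        obtain ⟨c, rfl⟩ := exists_smul_one h0 h1 x
        obtain ⟨a, e, rfl⟩ := hy.2 hn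
        rw [Subsingleton.elim i 0]
        refine ⟨c • a, c • e, ?_⟩
        simp only [map_smul, LinearMap.smul_apply, (freeOperad M).one_comp, smul_add]
      by_cases hm1 : m = 1
      · subst hm1
        obtain rfl : l = n := by omega
        obtain ⟨c, rfl⟩ := exists_smul_one h0 h1 y
        obtain ⟨a, e, rfl⟩ := hx.2 hn
        refine ⟨c • a, c • e, ?_⟩
        simp only [map_smul, (freeOperad M).comp_one, smul_add]
      -- Now `l, m ≥ 2` and `l + m = t + 1`, so both factors have arity below `t`.
      obtain ⟨a, rfl⟩ := hx.1 (by omega)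
      obtain ⟨b, rfl⟩ := hy.1 (by omega)
      exact ⟨Q.comp h i a b, 0, by rw [map_zero, add_zero, g.app_comp h i a b]⟩
  | act n σ x hx =>
    refine ⟨fun hn => ?_, fun hn => ?_⟩
    · obtain ⟨a, rfl⟩ := hx.1 hn
      exact ⟨_, (g.app_act n σ a).symm⟩
    · obtain ⟨a, e, rfl⟩ := hx.2 hn
      exact ⟨Q.act n σ a, M.act n σ e, by rw [map_add, g.app_act, (of M).app_act]⟩

end FreeOperad

/-! ### Invariant complements -/

/-- Maschke's theorem, for a finite group acting on the right. -/
theorem exists_invariant_complement {k : Type*} [Field k] [CharZero k] {G V : Type*} [Group G]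
    [Fintype G] [AddCommGroup V] [Module k V] (act : G → V →ₗ[k] V) (act_one : ∀ x, act 1 x = x)
    (act_mul : ∀ σ τ x, act (σ * τ) x = act τ (act σ x)) {Z B : Submodule k V} (hBZ : B ≤ Z)
    (hZ : ∀ σ x, x ∈ Z → act σ x ∈ Z) (hB : ∀ σ x, x ∈ B → act σ x ∈ B) :
    ∃ E : Submodule k V, E ≤ Z ∧ (∀ σ x, x ∈ E → act σ x ∈ E) ∧ (∀ x, x ∈ E → x ∈ B → x = 0) ∧
      ∀ z, z ∈ Z → ∃ e, e ∈ E ∧ ∃ b, b ∈ B ∧ z = e + b := by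
  obtain ⟨π, hπ⟩ := B.subtype.exists_leftInverse_of_injective B.ker_subtype
  have hπB : ∀ b (hb : b ∈ B), π b = ⟨b, hb⟩ := fun b hb =>
    congrArg (fun f => f ⟨b, hb⟩) hπ
  -- The average over the group of a linear projection onto `B`: still a projection onto `B`, now
  -- equivariant. The complement is its kernel inside `Z`.
  let q : V →ₗ[k] V := (Fintype.card G : k)⁻¹ • ∑ σ, act σ⁻¹ ∘ₗ B.subtype ∘ₗ π ∘ₗ act σ
  have hq : ∀ x, q x = (Fintype.card G : k)⁻¹ • ∑ σ, act σ⁻¹ (π (act σ x)) := fun x => by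
    simp [q, LinearMap.sum_apply]
  have hcard : (Fintype.card G : k) ≠ 0 := Nat.cast_ne_zero.2 Fintype.card_ne_zero
  have hqB : ∀ b, b ∈ B → q b = b := fun b hb => by
    rw [hq]
    have : ∀ σ, act σ⁻¹ (π (act σ b) : V) = b := fun σ => by
      rw [hπB _ (hB σ b hb), ← act_mul, mul_inv_cancel, act_one]
    simp only [this, Finset.sum_const, Finset.card_univ]
    rw [← Nat.cast_smul_eq_nsmul k, smul_smul, inv_mul_cancel₀ hcard, one_smul]
  have hq_mem : ∀ x, q x ∈ B := fun x => by
    rw [hq]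
    exact B.smul_mem _ (B.sum_mem fun σ _ => hB _ _ (π (act σ x)).2)
  have hq_act : ∀ τ x, q (act τ x) = act τ (q x) := fun τ x => by
    rw [hq, hq, map_smul, map_sum]
    congr 1
    -- For a right action, `act σ (act τ x) = act (τ * σ) x`, hence the reindexing by left
    -- multiplication.
    refine Fintype.sum_equiv (Equiv.mulLeft τ) _ _ fun σ => ?_
    simp only [Equiv.coe_mulLeft, ← act_mul, mul_inv_rev, inv_mul_cancel_right]
  refine ⟨Z ⊓ LinearMap.ker q, inf_le_left, fun σ x hx => ⟨hZ σ x hx.1, ?_⟩, fun x hx hxB => ?_,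
    fun z hz => ⟨z - q z, ⟨Z.sub_mem hz (hBZ (hq_mem z)), ?_⟩, q z, hq_mem z, by abel⟩⟩
  · have : q x = 0 := hx.2
    change q (act σ x) = 0
    rw [hq_act, this, map_zero]
  · have : q x = 0 := hx.2
    rw [← hqB x hxB, this]
  · change q (z - q z) = 0
    rw [map_sub, hqB _ (hq_mem z), sub_self]

/-! ### Homogeneous components -/

namespace GradedSigmaModule

variable {k : Type u} [Field k]

open DirectSum

/-- The projection to the homogeneous part of degree `p`. -/
noncomputable def component (M : GradedSigmaModule k) (n : ℕ) (p : ℤ) : M.obj n →ₗ[k] M.obj n :=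
  M.ofDegrees fun q => if q = p then (M.deg n q).subtype else 0

theorem component_of_mem (M : GradedSigmaModule k) {n : ℕ} {p : ℤ} {x : M.obj n}
    (hx : x ∈ M.deg n p) : M.component n p x = x := by
  rw [component, M.ofDegrees_apply _ ⟨x, hx⟩, if_pos rfl]
  rfl

theorem component_of_ne (M : GradedSigmaModule k) {n : ℕ} {p q : ℤ} {x : M.obj n}
    (hx : x ∈ M.deg n q) (h : q ≠ p) : M.component n p x = 0 := by
  rw [component, M.ofDegrees_apply _ ⟨x, hx⟩, if_neg h]
  rfl

theorem component_mem (M : GradedSigmaModule k) {n : ℕ} (p : ℤ) (x : M.obj n) :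
    M.component n p x ∈ M.deg n p := by
  induction x using M.homogeneous_induction with
  | hom q x hx =>
    by_cases h : q = p
    · subst h
      rwa [M.component_of_mem hx]
    · rw [M.component_of_ne hx h]
      exact Submodule.zero_mem _
  | add x y hx hy =>
    rw [map_add]
    exact Submodule.add_mem _ hx hy

theorem component_map {M N : GradedSigmaModule k} {n m : ℕ} (f : M.obj n →ₗ[k] N.obj m) (s : ℤ)
    (hf : ∀ p x, x ∈ M.deg n p → f x ∈ N.deg m (p + s)) (p : ℤ) (x : M.obj n) :
    N.component m (p + s) (f x) = f (M.component n p x) := by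
  induction x using M.homogeneous_induction with
  | hom q x hx =>
    by_cases h : q = p
    · subst h
      rw [M.component_of_mem hx, N.component_of_mem (hf _ _ hx)]
    · rw [M.component_of_ne hx h, N.component_of_ne (hf _ _ hx) (by omega), map_zero]
  | add x y hx hy => simp only [map_add, hx, hy]

/-- Allowing every finite set of degrees that contains the support lets two elements be summed over
a common set, as is done in `exists_eq_attached_add`. -/
theorem exists_sum_component (M : GradedSigmaModule k) {n : ℕ} (x : M.obj n) :
    ∃ S : Finset ℤ, ∀ T, S ⊆ T → ∑ p ∈ T, M.component n p x = x := by
  classical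
  induction x using M.homogeneous_induction with
  | hom q x hx =>
    refine ⟨{q}, fun T hT => ?_⟩
    rw [Finset.sum_eq_single q, M.component_of_mem hx]
    · exact fun p _ hp => M.component_of_ne hx hp.symm
    · exact fun h => absurd (hT (Finset.mem_singleton_self q)) h
  | add x y hx hy =>
    obtain ⟨S, hS⟩ := hx
    obtain ⟨S', hS'⟩ := hy
    refine ⟨S ∪ S', fun T hT => ?_⟩
    simp only [map_add, Finset.sum_add_distrib]
    rw [hS T (Finset.subset_union_left.trans hT), hS' T (Finset.subset_union_right.trans hT)]

end GradedSigmaModule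

/-! ### The mapping cone and the generators that kill its cohomology -/

namespace DGOperad

variable {k : Type u} [Field k] {A P : DGOperad k} (ρ : A ⟶ P)

theorem homApp_mem {n : ℕ} {p : ℤ} {x : A.obj n} (hx : x ∈ A.deg n p) :
    homApp ρ n x ∈ P.deg n p :=
  (gradedHom ρ).app_mem n p x hx

theorem homApp_act {n : ℕ} (σ : Equiv.Perm (Fin n)) (x : A.obj n) :
    homApp ρ n (A.act n σ x) = P.act n σ (homApp ρ n x) :=
  (gradedHom ρ).app_act n σ x

theorem component_diff (Q : DGOperad k) {m : ℕ} (p : ℤ) (x : Q.obj m) :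
    Q.component m (p + 1) (Q.diff m x) = Q.diff m (Q.component m p x) :=
  GradedSigmaModule.component_map (M := Q.toGradedSigmaModule) (N := Q.toGradedSigmaModule)
    (Q.diff m) 1 (Q.diff_mem m) p x

theorem component_homApp {m : ℕ} (p : ℤ) (x : A.obj m) :
    P.component m p (homApp ρ m x) = homApp ρ m (A.component m p x) := by
  have := GradedSigmaModule.component_map (M := A.toGradedSigmaModule)
    (N := P.toGradedSigmaModule) (homApp ρ m) 0
    (fun q x hx => by rw [add_zero]; exact homApp_mem ρ hx) p x
  rwa [add_zero] at this

/-- The cocycles of degree `p` in the mapping cone of `ρ` in arity `n`. -/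
def coneCocycles (n : ℕ) (p : ℤ) : Submodule k (A.obj n × P.obj n) where
  carrier := {z | z.1 ∈ A.deg n (p + 1) ∧ z.2 ∈ P.deg n p ∧ A.diff n z.1 = 0 ∧
    P.diff n z.2 = homApp ρ n z.1}
  add_mem' := by
    rintro z w ⟨h1, h2, h3, h4⟩ ⟨h1', h2', h3', h4'⟩
    refine ⟨Submodule.add_mem _ h1 h1', Submodule.add_mem _ h2 h2', ?_, ?_⟩
    · rw [Prod.fst_add, map_add, h3, h3', add_zero]
    · rw [Prod.fst_add, Prod.snd_add, map_add, map_add, h4, h4']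
  zero_mem' := by simp
  smul_mem' := by
    rintro c z ⟨h1, h2, h3, h4⟩
    refine ⟨Submodule.smul_mem _ c h1, Submodule.smul_mem _ c h2, ?_, ?_⟩
    · rw [Prod.smul_fst, map_smul, h3, smul_zero]
    · rw [Prod.smul_fst, Prod.smul_snd, map_smul, map_smul, h4]

/-- The coboundaries of degree `p` in the mapping cone of `ρ` in arity `n`. -/
def coneCoboundaries (n : ℕ) (p : ℤ) : Submodule k (A.obj n × P.obj n) where
  -- The usual sign on `dx` is omitted: replacing `x` by `-x` gives the same subspace.
  carrier := {z | ∃ a ∈ A.deg n p, ∃ x ∈ P.deg n (p - 1),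
    z = (A.diff n a, homApp ρ n a + P.diff n x)}
  add_mem' := by
    rintro _ _ ⟨a, ha, x, hx, rfl⟩ ⟨a', ha', x', hx', rfl⟩
    refine ⟨a + a', Submodule.add_mem _ ha ha', x + x', Submodule.add_mem _ hx hx', ?_⟩
    simp only [map_add, Prod.mk_add_mk]
    congr 1
    abel
  zero_mem' := ⟨0, Submodule.zero_mem _, 0, Submodule.zero_mem _, by simp only [map_zero, add_zero]; rfl⟩
  smul_mem' := by
    rintro c _ ⟨a, ha, x, hx, rfl⟩
    exact ⟨c • a, Submodule.smul_mem _ c ha, c • x, Submodule.smul_mem _ c hx, by simp⟩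

/-- The action of permutations on the mapping cone. -/
def coneAct (A P : DGOperad k) (n : ℕ) (σ : Equiv.Perm (Fin n)) :
    A.obj n × P.obj n →ₗ[k] A.obj n × P.obj n :=
  (A.act n σ).prodMap (P.act n σ)

/-- The only place where characteristic zero enters, through the order of the symmetric group.
Stability of the complement is what makes it a `Σ`-module of generators. -/
theorem exists_coneComplement [CharZero k] (n : ℕ) (p : ℤ) :
    ∃ E : Submodule k (A.obj n × P.obj n), E ≤ coneCocycles ρ n p ∧
      (∀ σ x, x ∈ E → coneAct A P n σ x ∈ E) ∧
      (∀ x, x ∈ E → x ∈ coneCoboundaries ρ n p → x = 0) ∧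
      ∀ z, z ∈ coneCocycles ρ n p → ∃ e, e ∈ E ∧ ∃ b, b ∈ coneCoboundaries ρ n p ∧ z = e + b := by
  refine exists_invariant_complement (coneAct A P n) (fun x => ?_) (fun σ τ x => ?_) ?_ ?_ ?_
  · simp [coneAct, A.act_one, P.act_one]
  · simp [coneAct, A.act_mul, P.act_mul]
  · rintro _ ⟨a, ha, x, hx, rfl⟩
    refine ⟨A.diff_mem n p a ha, Submodule.add_mem _ (homApp_mem ρ ha) ?_, A.diff_diff n a, ?_⟩
    · have := P.diff_mem n _ x hx
      rwa [sub_add_cancel] at this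
    · simp only
      rw [map_add, P.diff_diff, add_zero, homApp_diff]
  · rintro σ z ⟨h1, h2, h3, h4⟩
    refine ⟨A.act_mem _ _ _ _ h1, P.act_mem _ _ _ _ h2, ?_, ?_⟩
    · exact (A.diff_act n σ z.1).trans (by rw [h3, map_zero])
    · exact (P.diff_act n σ z.2).trans (by rw [h4]; exact (homApp_act ρ σ z.1).symm)
  · rintro σ _ ⟨a, ha, x, hx, rfl⟩
    refine ⟨A.act n σ a, A.act_mem _ _ _ _ ha, P.act n σ x, P.act_mem _ _ _ _ hx, ?_⟩
    simp only [coneAct, LinearMap.prodMap_apply, map_add, A.diff_act, P.diff_act, homApp_act]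

/-- An equivariant complement of the coboundaries in the cocycles of the mapping cone. -/
noncomputable def coneComplement [CharZero k] (n : ℕ) (p : ℤ) :
    Submodule k (A.obj n × P.obj n) :=
  (exists_coneComplement ρ n p).choose

/-- The homogeneous part of `attachedGenerators`. -/
noncomputable def attachedPart [CharZero k] (n m : ℕ) (p : ℤ) :
    Submodule k (A.obj m × P.obj m) :=
  if m = n then coneComplement ρ m p else ⊥

theorem attachedPart_self [CharZero k] (n : ℕ) (p : ℤ) :
    attachedPart ρ n n p = coneComplement ρ n p :=
  if_pos rfl

theorem attachedPart_of_ne [CharZero k] {n m : ℕ} (h : m ≠ n) (p : ℤ) :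
    attachedPart ρ n m p = ⊥ :=
  if_neg h

theorem attachedPart_le [CharZero k] (n m : ℕ) (p : ℤ) :
    attachedPart ρ n m p ≤ coneCocycles ρ m p := by
  rw [attachedPart]
  split_ifs
  · exact (exists_coneComplement ρ m p).choose_spec.1
  · exact bot_le

theorem coneAct_mem [CharZero k] (n m : ℕ) (p : ℤ) (σ : Equiv.Perm (Fin m))
    (x : A.obj m × P.obj m) (hx : x ∈ attachedPart ρ n m p) :
    coneAct A P m σ x ∈ attachedPart ρ n m p := by
  rw [attachedPart] at *
  split_ifs at * with h
  · exact (exists_coneComplement ρ m p).choose_spec.2.1 σ x hx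
  · rw [Submodule.mem_bot] at *
    rw [hx, map_zero]

/-- The graded `Σ`-module of arity `n` representing the cohomology of the mapping cone of `ρ`. -/
@[reducible] noncomputable def attachedGenerators [CharZero k] (n : ℕ) : GradedSigmaModule k :=
  GradedSigmaModule.ofHomogeneous (fun m p => attachedPart ρ n m p)
    (fun m p σ => (coneAct A P m σ).restrict (coneAct_mem ρ n m p σ))
    (fun m p x => Subtype.ext (by simp [coneAct, A.act_one, P.act_one]))
    (fun m p σ τ x => Subtype.ext (by simp [coneAct, A.act_mul, P.act_mul]))

variable [CharZero k] (n : ℕ)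

theorem attachedGenerators_subsingleton {m : ℕ} (h : m ≠ n) :
    Subsingleton ((attachedGenerators ρ n).obj m) := by
  refine ⟨fun x y => DFinsupp.ext fun p => Subtype.ext ?_⟩
  have : ∀ z : attachedPart ρ n m p, z.1 = 0 := fun z => by
    simpa [attachedPart_of_ne ρ h] using z.2
  rw [this, this]

/-- The inclusion of the generators into the mapping cone. -/
noncomputable def attachedToCone (m : ℕ) :
    (attachedGenerators ρ n).obj m →ₗ[k] A.obj m × P.obj m :=
  DirectSum.toModule k ℤ _ fun p => (attachedPart ρ n m p).subtype

theorem attachedToCone_lof {m : ℕ} {p : ℤ} (x : attachedPart ρ n m p) :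
    attachedToCone ρ n m (DirectSum.lof k ℤ (fun p => attachedPart ρ n m p) p x) = x := by
  simp [attachedToCone]

theorem attachedToCone_mem {m : ℕ} {p : ℤ} {x : (attachedGenerators ρ n).obj m}
    (hx : x ∈ (attachedGenerators ρ n).deg m p) :
    attachedToCone ρ n m x ∈ coneCocycles ρ m p := by
  obtain ⟨x, rfl⟩ := hx
  rw [attachedToCone_lof]
  exact attachedPart_le ρ n m p x.2

theorem attachedToCone_act {m : ℕ} (σ : Equiv.Perm (Fin m)) (x : (attachedGenerators ρ n).obj m) :
    attachedToCone ρ n m ((attachedGenerators ρ n).act m σ x) =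
      coneAct A P m σ (attachedToCone ρ n m x) := by
  induction x using (attachedGenerators ρ n).homogeneous_induction with
  | hom p x hx =>
    obtain ⟨x, rfl⟩ := hx
    rw [attachedToCone_lof, DirectSum.lmap_lof, attachedToCone_lof]
    rfl
  | add x y hx hy => simp only [map_add, hx, hy]

/-- The attaching map. -/
noncomputable def attachingMap :
    GradedSigmaModule.ShiftHom (attachedGenerators ρ n) A.toGradedSigmaModule where
  app _ := LinearMap.fst k _ _ ∘ₗ attachedToCone ρ n _
  app_mem _ _ _ hx := (attachedToCone_mem ρ n hx).1
  app_act _ σ x := congrArg Prod.fst (attachedToCone_act ρ n σ x)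

/-- The map on the attached generators extending `ρ`. -/
noncomputable def attachedMap :
    GradedSigmaModule.Hom (attachedGenerators ρ n) P.toGradedSigmaModule where
  app _ := LinearMap.snd k _ _ ∘ₗ attachedToCone ρ n _
  app_mem _ _ _ hx := (attachedToCone_mem ρ n hx).2.1
  app_act _ σ x := congrArg Prod.snd (attachedToCone_act ρ n σ x)

theorem diff_attachingMap {m : ℕ} (x : (attachedGenerators ρ n).obj m) :
    A.diff m ((attachingMap ρ n).app m x) = 0 := by
  induction x using (attachedGenerators ρ n).homogeneous_induction with
  | hom p x hx => exact (attachedToCone_mem ρ n hx).2.2.1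
  | add x y hx hy => simp only [map_add, hx, hy, add_zero]

theorem diff_attachedMap {m : ℕ} (x : (attachedGenerators ρ n).obj m) :
    P.diff m ((attachedMap ρ n).app m x) = homApp ρ m ((attachingMap ρ n).app m x) := by
  induction x using (attachedGenerators ρ n).homogeneous_induction with
  | hom p x hx => exact (attachedToCone_mem ρ n hx).2.2.2
  | add x y hx hy => simp only [map_add, hx, hy]

/-- Together with `component_attachedMap` this recovers each coordinate of a sum of generators from
its two images, so that statements about the cone can be checked one degree at a time. The shift by
one reflects the degree of the attaching map. -/
theorem component_attachingMap {m : ℕ} (p : ℤ) (x : (attachedGenerators ρ n).obj m) :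
    A.component m (p + 1) ((attachingMap ρ n).app m x) = (x p : A.obj m × P.obj m).1 := by
  induction x using DirectSum.induction_on with
  | zero => simp
  | of q x =>
    change A.component m (p + 1) (attachedToCone ρ n m
      (DirectSum.lof k ℤ (fun p => attachedPart ρ n m p) q x)).1 = _
    rw [attachedToCone_lof]
    have hx := attachedPart_le ρ n m q x.2
    by_cases h : q = p
    · subst h
      rw [A.component_of_mem hx.1, DirectSum.of_eq_same]
    · rw [A.component_of_ne hx.1 (by omega), DirectSum.of_eq_of_ne _ _ _ (Ne.symm h)]
      rfl
  | add x y hx hy =>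
    rw [map_add, map_add, hx, hy]
    rfl

theorem component_attachedMap {m : ℕ} (p : ℤ) (x : (attachedGenerators ρ n).obj m) :
    P.component m p ((attachedMap ρ n).app m x) = (x p : A.obj m × P.obj m).2 := by
  induction x using DirectSum.induction_on with
  | zero => simp
  | of q x =>
    change P.component m p (attachedToCone ρ n m
      (DirectSum.lof k ℤ (fun p => attachedPart ρ n m p) q x)).2 = _
    rw [attachedToCone_lof]
    have hx := attachedPart_le ρ n m q x.2
    by_cases h : q = p
    · subst h
      rw [P.component_of_mem hx.2.1, DirectSum.of_eq_same]
    · rw [P.component_of_ne hx.2.1 h, DirectSum.of_eq_of_ne _ _ _ (Ne.symm h)]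
      rfl
  | add x y hx hy =>
    rw [map_add, map_add, hx, hy]
    rfl

/-- An attached generator that bounds in the mapping cone is zero. -/
theorem eq_zero_of_coneCoboundary (e : (attachedGenerators ρ n).obj n) (a : A.obj n) (x : P.obj n)
    (ha : (attachingMap ρ n).app n e = A.diff n a)
    (hx : (attachedMap ρ n).app n e = homApp ρ n a + P.diff n x) : e = 0 := by
  refine DFinsupp.ext fun p => Subtype.ext ?_
  have hmem : (e p).1 ∈ coneComplement ρ n p := attachedPart_self ρ n p ▸ (e p).2
  refine (exists_coneComplement ρ n p).choose_spec.2.2.1 _ hmem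
    ⟨A.component n p a, A.component_mem p a, P.component n (p - 1) x, P.component_mem _ x,
      Prod.ext ?_ ?_⟩
  · rw [← component_attachingMap, ha, component_diff]
  · have := component_diff P (p - 1) x
    rw [sub_add_cancel] at this
    rw [← component_attachedMap, hx, map_add, component_homApp, this]

/-- The attached generators span the cohomology of the mapping cone. -/
theorem exists_eq_attached_add (a : A.obj n) (x : P.obj n) (ha : A.diff n a = 0)
    (hx : P.diff n x = homApp ρ n a) :
    ∃ (e : (attachedGenerators ρ n).obj n) (a' : A.obj n) (x' : P.obj n),
      a = (attachingMap ρ n).app n e + A.diff n a' ∧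
      x = (attachedMap ρ n).app n e + (homApp ρ n a' + P.diff n x') := by
  classical
  have key : ∀ p : ℤ, ∃ (e : (attachedGenerators ρ n).obj n) (a' : A.obj n) (x' : P.obj n),
      A.component n (p + 1) a = (attachingMap ρ n).app n e + A.diff n a' ∧
      P.component n p x = (attachedMap ρ n).app n e + (homApp ρ n a' + P.diff n x') := by
    intro p
    have hz : (A.component n (p + 1) a, P.component n p x) ∈ coneCocycles ρ n p := by
      refine ⟨A.component_mem _ a, P.component_mem _ x, ?_, ?_⟩
      · rw [← component_diff, ha, map_zero]
      · rw [← component_diff, hx, component_homApp]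
    obtain ⟨e, he, _, ⟨a', _, x', _, rfl⟩, hzz⟩ :=
      (exists_coneComplement ρ n p).choose_spec.2.2.2 _ hz
    have he' : e ∈ attachedPart ρ n n p := by rwa [attachedPart_self]
    have hE := attachedToCone_lof ρ n ⟨e, he'⟩
    refine ⟨DirectSum.lof k ℤ (fun p => attachedPart ρ n n p) p ⟨e, he'⟩, a', x', ?_, ?_⟩
    · exact (congrArg Prod.fst hzz).trans (congrArg (fun z => z.1 + A.diff n a') hE.symm)
    · exact (congrArg Prod.snd hzz).trans
        (congrArg (fun z => z.2 + (homApp ρ n a' + P.diff n x')) hE.symm)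
  choose e a' x' h1 h2 using key
  obtain ⟨S, hS⟩ := A.exists_sum_component a
  obtain ⟨S', hS'⟩ := P.exists_sum_component x
  -- The first coordinate of a cone element of degree `p` has degree `p + 1`, so the support of `a`
  -- is shifted down to index both sums by the same degrees.
  let T := S.image (fun p => p - 1) ∪ S'
  refine ⟨∑ p ∈ T, e p, ∑ p ∈ T, a' p, ∑ p ∈ T, x' p, ?_, ?_⟩
  · rw [map_sum, map_sum, ← Finset.sum_add_distrib, ← Finset.sum_congr rfl fun p _ => h1 p]
    have := hS (T.image (fun p => p + 1)) fun p hp => Finset.mem_image.2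
      ⟨p - 1, Finset.mem_union_left _ (Finset.mem_image_of_mem _ hp), by ring⟩
    rw [Finset.sum_image (fun p _ q _ h => by simpa using h)] at this
    exact this.symm
  · rw [map_sum, map_sum, map_sum, ← Finset.sum_add_distrib, ← Finset.sum_add_distrib,
      ← Finset.sum_congr rfl fun p _ => h2 p]
    exact (hS' T Finset.subset_union_right).symm

end DGOperad

/-! ### Direct sums of generators and functoriality of the free operad -/

namespace GradedSigmaModule

variable {k : Type u} [Field k]

/-- The zero graded `Σ`-module. -/
def trivial (k : Type u) [Field k] : GradedSigmaModule k where
  obj _ := PUnit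
  deg _ _ := ⊥
  isInternal _ := ⟨fun _ _ _ => DFinsupp.ext fun _ => Subsingleton.elim _ _,
    fun _ => ⟨DirectSum.of _ 0 0, Subsingleton.elim _ _⟩⟩
  act _ _ := LinearMap.id
  act_one _ _ := rfl
  act_mul _ _ _ _ := rfl
  act_mem _ _ _ _ h := h

instance (n : ℕ) : Subsingleton ((trivial k).obj n) :=
  inferInstanceAs (Subsingleton PUnit)

/-- The identity morphism. -/
def Hom.id (M : GradedSigmaModule k) : Hom M M where
  app _ := LinearMap.id
  app_mem _ _ _ h := h
  app_act _ _ _ := rfl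

/-- The zero morphism. -/
def Hom.zero (M N : GradedSigmaModule k) : Hom M N where
  app _ := 0
  app_mem _ _ _ _ := Submodule.zero_mem _
  app_act _ _ _ := by simp

/-- The inclusion `M → M ⊕ E`. -/
def Hom.inl (M E : GradedSigmaModule k) : Hom M (M.sum E) where
  app _ := LinearMap.inl k _ _
  app_mem _ _ _ h := ⟨h, Submodule.zero_mem _⟩
  app_act n σ _ := Prod.ext rfl (map_zero (E.act n σ)).symm

/-- The inclusion `E → M ⊕ E`. -/
def Hom.inr (M E : GradedSigmaModule k) : Hom E (M.sum E) where
  app _ := LinearMap.inr k _ _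
  app_mem _ _ _ h := ⟨Submodule.zero_mem _, h⟩
  app_act n σ _ := Prod.ext (map_zero (M.act n σ)).symm rfl

/-- The projection `M ⊕ E → M`. -/
def Hom.fst (M E : GradedSigmaModule k) : Hom (M.sum E) M where
  app _ := LinearMap.fst k _ _
  app_mem _ _ _ h := h.1
  app_act _ _ _ := rfl

/-- The morphism to `M ⊕ E` with given components. -/
def Hom.prod {N M E : GradedSigmaModule k} (f : Hom N M) (g : Hom N E) : Hom N (M.sum E) where
  app n := (f.app n).prod (g.app n)
  app_mem n p x h := ⟨f.app_mem n p x h, g.app_mem n p x h⟩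
  app_act n σ x := Prod.ext (f.app_act n σ x) (g.app_act n σ x)

end GradedSigmaModule

open GradedSigmaModule

namespace GradedOperad

variable {k : Type u} [Field k]

/-- The identity morphism. -/
def Hom.id (P : GradedOperad k) : Hom P P where
  toSigmaHom := GradedSigmaModule.Hom.id _
  app_one := rfl
  app_comp _ _ _ _ := rfl

/-- Composition (first `f`, then `g`). -/
def Hom.comp {P Q R : GradedOperad k} (f : Hom P Q) (g : Hom Q R) : Hom P R where
  toSigmaHom := f.toSigmaHom.comp g.toSigmaHom
  app_one := by simp [GradedSigmaModule.Hom.comp, f.app_one, g.app_one]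
  app_comp h i x y := by simp [GradedSigmaModule.Hom.comp, f.app_comp, g.app_comp]

end GradedOperad

namespace FreeOperad

variable {k : Type u} [Field k] {M N : GradedSigmaModule k}

/-- The morphism of free operads induced by a morphism of graded `Σ`-modules. -/
noncomputable def map (f : Hom M N) : GradedOperad.Hom (freeOperad M) (freeOperad N) :=
  lift (f.comp (of N))

theorem map_of (f : Hom M N) {n : ℕ} (x : M.obj n) :
    (map f).app n ((of M).app n x) = (of N).app n (f.app n x) :=
  lift_of _ x

theorem lift_map {Q : GradedOperad k} (f : Hom M N) (g : Hom N Q.toGradedSigmaModule)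
    (h : Hom M Q.toGradedSigmaModule) (hfg : ∀ n x, g.app n (f.app n x) = h.app n x) (n : ℕ)
    (x : (freeOperad M).obj n) : (lift g).app n ((map f).app n x) = (lift h).app n x :=
  app_eq (g := (map f).comp (lift g)) (g' := lift h)
    (fun n x => by
      change (lift g).app n ((map f).app n ((of M).app n x)) = _
      rw [map_of, lift_of, lift_of, hfg]) n x

/-- A left inverse on generators induces a left inverse on free operads. It is used for the
underlying graded operads only; the retraction need not respect differentials. -/
theorem map_injective (f : Hom M N) (g : Hom N M) (hfg : ∀ n x, g.app n (f.app n x) = x) (n : ℕ) :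
    Function.Injective ((map f).app n) := by
  have key : ∀ x, (map g).app n ((map f).app n x) = x := fun x =>
    app_eq (g := (map f).comp (map g)) (g' := GradedOperad.Hom.id _)
      (fun n x => by
        change (map g).app n ((map f).app n ((of M).app n x)) = _
        rw [map_of, map_of, hfg]
        rfl) n x
  intro x y h
  rw [← key x, ← key y, h]

/-- A morphism to a free operad is surjective in arity `t` if all generators of arity at most `t`
are in its range. -/
theorem app_surjective {Q : GradedOperad k} (g : GradedOperad.Hom Q (freeOperad M)) (t : ℕ)
    (h0 : Subsingleton (M.obj 0)) (h1 : Subsingleton (M.obj 1))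
    (hle : ∀ n, n ≤ t → ∀ x, ∃ y, (of M).app n x = g.app n y) :
    Function.Surjective (g.app t) := by
  intro x
  obtain ⟨y, e, rfl⟩ := eq_app_add_of g t h0 h1 (fun n hn => hle n hn.le) x
  obtain ⟨z, hz⟩ := hle t le_rfl e
  exact ⟨y + z, by rw [map_add, hz]⟩

/-- A morphism of graded operads from a free operad that is compatible with differentials on
generators, as a morphism of dg operads. -/
def dgHom {d : GradedSigmaModule.ShiftHom M (freeOperad M).toGradedSigmaModule}
    {hd : ∀ n x, (derivation d).app n (d.app n x) = 0} {Q : DGOperad k}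
    (g : GradedOperad.Hom (freeOperad M) Q.toGradedOperad)
    (h : ∀ n x, g.app n (d.app n x) = Q.diff n (g.app n ((of M).app n x))) : dgOperad d hd ⟶ Q :=
  DGOperad.Hom.mk g
    (app_derivation (derivation d) Q.derivation g fun n x => by
      rw [derivation_of, h]
      rfl)

theorem dgHom_ext {d : GradedSigmaModule.ShiftHom M (freeOperad M).toGradedSigmaModule}
    {hd : ∀ n x, (derivation d).app n (d.app n x) = 0} {Q : DGOperad k}
    {φ ψ : dgOperad d hd ⟶ Q}
    (h : ∀ n x, DGOperad.homApp φ n ((of M).app n x) = DGOperad.homApp ψ n ((of M).app n x)) :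
    φ = ψ := by
  have : DGOperad.gradedHom φ = DGOperad.gradedHom ψ := hom_ext h
  exact DGOperad.Hom.ext (congrArg (fun g => g.app) this)

end FreeOperad

/-! ### Cohomology isomorphisms in terms of elements -/

namespace DGOperad

variable {k : Type u} [Field k]

theorem mkQ_eq_iff {P : DGOperad k} {n : ℕ} (x y : P.cocycles n) :
    (P.coboundaries n).mkQ x = (P.coboundaries n).mkQ y ↔
      ∃ z, (x : P.obj n) = (y : P.obj n) + P.diff n z := by
  rw [Submodule.mkQ_apply, Submodule.mkQ_apply, Submodule.Quotient.eq]
  constructor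
  · rintro ⟨z, hz⟩
    exact ⟨z, by rw [hz]; simp⟩
  · rintro ⟨z, hz⟩
    exact ⟨z, by simp [hz]⟩

/-- Replaces quotients by elements: injectivity says that a cocycle with exact image is exact,
surjectivity that every cocycle is an image up to a coboundary. These are the data of a cone cocycle
`(x, y)`, or `(0, y)`. -/
theorem bijective_cohomologyMap {A P : DGOperad k} (ρ : A ⟶ P) (n : ℕ) :
    Function.Bijective (cohomologyMap ρ n) ↔
      (∀ x y, A.diff n x = 0 → homApp ρ n x = P.diff n y → ∃ a, x = A.diff n a) ∧
      ∀ y, P.diff n y = 0 → ∃ x z, A.diff n x = 0 ∧ y = homApp ρ n x + P.diff n z := by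
  have hmap : ∀ x : A.cocycles n, cohomologyMap ρ n ((A.coboundaries n).mkQ x) =
      (P.coboundaries n).mkQ (cocyclesMap ρ n x) := fun _ => rfl
  refine and_congr ?_ ?_
  · rw [injective_iff_map_eq_zero]
    constructor
    · intro h x y hx hxy
      have := h ((A.coboundaries n).mkQ ⟨x, hx⟩) (by
        rw [hmap, ← map_zero (P.coboundaries n).mkQ, mkQ_eq_iff]
        exact ⟨y, by rw [ZeroMemClass.coe_zero, zero_add, ← hxy]; rfl⟩)
      rw [← map_zero (A.coboundaries n).mkQ, mkQ_eq_iff] at this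
      obtain ⟨a, ha⟩ := this
      exact ⟨a, by simpa using ha⟩
    · intro h c hc
      obtain ⟨⟨x, hx⟩, rfl⟩ := (A.coboundaries n).mkQ_surjective c
      rw [hmap, ← map_zero (P.coboundaries n).mkQ, mkQ_eq_iff] at hc
      obtain ⟨y, hy⟩ := hc
      obtain ⟨a, ha⟩ := h x y hx (hy.trans (zero_add _))
      rw [← map_zero (A.coboundaries n).mkQ, mkQ_eq_iff]
      exact ⟨a, by simpa using ha⟩
  · constructor
    · intro h y hy
      obtain ⟨c, hc⟩ := h ((P.coboundaries n).mkQ ⟨y, hy⟩)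
      obtain ⟨⟨x, hx⟩, rfl⟩ := (A.coboundaries n).mkQ_surjective c
      obtain ⟨z, hz⟩ := (mkQ_eq_iff _ _).1 hc.symm
      exact ⟨x, z, hx, hz⟩
    · intro h c
      obtain ⟨⟨y, hy⟩, rfl⟩ := (P.coboundaries n).mkQ_surjective c
      obtain ⟨x, z, hx, hz⟩ := h y hy
      exact ⟨(A.coboundaries n).mkQ ⟨x, hx⟩, ((mkQ_eq_iff _ _).2 ⟨z, hz⟩).symm⟩

theorem homApp_comp {A B P : DGOperad k} (φ : A ⟶ B) (ψ : B ⟶ P) (n : ℕ) (x : A.obj n) :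
    homApp (φ ≫ ψ) n x = homApp ψ n (homApp φ n x) :=
  rfl

/-- Transfers what is known at one stage to the next stage, and to the limit, in an arity where the
inclusion is an isomorphism of complexes. -/
theorem bijective_cohomologyMap_of_comp {A B P : DGOperad k} (φ : A ⟶ B) (ψ : B ⟶ P) (n : ℕ)
    (hφ : Function.Bijective (homApp φ n)) (h : Function.Bijective (cohomologyMap (φ ≫ ψ) n)) :
    Function.Bijective (cohomologyMap ψ n) := by
  rw [bijective_cohomologyMap] at h ⊢
  refine ⟨fun x y hx hxy => ?_, fun y hy => ?_⟩
  · obtain ⟨x, rfl⟩ := hφ.2 x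
    obtain ⟨a, rfl⟩ := h.1 x y (hφ.1 (by rw [homApp_diff, hx, map_zero])) hxy
    exact ⟨homApp φ n a, homApp_diff φ n a⟩
  · obtain ⟨x, z, hx, hz⟩ := h.2 y hy
    exact ⟨homApp φ n x, z, by rw [← homApp_diff, hx, map_zero], hz⟩

theorem homApp_one {A P : DGOperad k} (φ : A ⟶ P) : homApp φ 1 A.one = P.one :=
  (gradedHom φ).app_one

theorem smul_one_injective_of_coboundary {P : DGOperad k} (h1 : P.IsCohomologicallyConnected)
    {c : k} {y : P.obj 1} (h : c • P.one = P.diff 1 y) : c = 0 := by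
  refine h1.1 ?_
  change c • (P.coboundaries 1).mkQ ⟨P.one, P.diff_one⟩ =
    (0 : k) • (P.coboundaries 1).mkQ ⟨P.one, P.diff_one⟩
  rw [← map_smul, ← map_smul, mkQ_eq_iff]
  exact ⟨y, by simpa using h⟩

theorem exists_smul_one_add {P : DGOperad k} (h1 : P.IsCohomologicallyConnected) {y : P.obj 1}
    (hy : P.diff 1 y = 0) : ∃ (c : k) (z : P.obj 1), y = c • P.one + P.diff 1 z := by
  obtain ⟨c, hc⟩ := h1.2 ((P.coboundaries 1).mkQ ⟨y, hy⟩)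
  change c • (P.coboundaries 1).mkQ ⟨P.one, P.diff_one⟩ = _ at hc
  rw [← map_smul] at hc
  obtain ⟨z, hz⟩ := (mkQ_eq_iff _ _).1 hc.symm
  exact ⟨c, z, hz⟩

theorem exists_eq_diff {P : DGOperad k} (h0 : P.IsCohomologicallyNonUnitary) {y : P.obj 0}
    (hy : P.diff 0 y = 0) : ∃ z, y = P.diff 0 z := by
  have h : Subsingleton (P.cohomology 0) := h0
  obtain ⟨z, hz⟩ := (mkQ_eq_iff (⟨y, hy⟩ : P.cocycles 0) 0).1 (Subsingleton.elim _ _)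
  exact ⟨z, by simpa using hz⟩

/-! ### Free models over `P` and the attachment of generators -/

/-- A dg operad over `P` that is free as a graded operad. -/
structure FreeModel (P : DGOperad k) where
  M : GradedSigmaModule k
  d : GradedSigmaModule.ShiftHom M (freeOperad M).toGradedSigmaModule
  diff_d : ∀ n x, (FreeOperad.derivation d).app n (d.app n x) = 0
  f : GradedSigmaModule.Hom M P.toGradedSigmaModule
  f_d : ∀ n x, (FreeOperad.lift f).app n (d.app n x) = P.diff n (f.app n x)

namespace FreeModel

open FreeOperad

variable {P : DGOperad k} (s : FreeModel P)

/-- The dg operad of a free model. -/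
@[reducible] def operad : DGOperad k :=
  dgOperad s.d s.diff_d

/-- The structure morphism of a free model. -/
def toTarget : s.operad ⟶ P :=
  dgHom (lift s.f) fun n x => by rw [s.f_d, lift_of]

theorem diff_of {n : ℕ} (x : s.M.obj n) :
    s.operad.diff n ((of s.M).app n x) = s.d.app n x :=
  derivation_of s.d x

theorem bijective_cohomologyMap_zero (hM0 : Subsingleton (s.M.obj 0))
    (h0 : P.IsCohomologicallyNonUnitary) : Function.Bijective (cohomologyMap s.toTarget 0) := by
  rw [bijective_cohomologyMap]
  refine ⟨fun x y _ _ => ⟨0, ?_⟩, fun y hy => ?_⟩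
  · rw [map_zero]
    exact eq_zero_of_arity_zero hM0 x
  · obtain ⟨z, rfl⟩ := exists_eq_diff h0 hy
    exact ⟨0, z, map_zero _, by rw [map_zero, zero_add]⟩

/-- In arity one the free operad consists of the multiples of the unit, with zero differential, so
the comparison map is `k → HP(1)`. -/
theorem bijective_cohomologyMap_one (hM0 : Subsingleton (s.M.obj 0))
    (hM1 : Subsingleton (s.M.obj 1)) (h1 : P.IsCohomologicallyConnected) :
    Function.Bijective (cohomologyMap s.toTarget 1) := by
  rw [bijective_cohomologyMap]
  refine ⟨fun x y _ hxy => ⟨0, ?_⟩, fun y hy => ?_⟩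
  · obtain ⟨c, rfl⟩ := exists_smul_one hM0 hM1 x
    rw [map_smul, homApp_one] at hxy
    rw [smul_one_injective_of_coboundary h1 hxy, zero_smul, map_zero]
  · obtain ⟨c, z, rfl⟩ := exists_smul_one_add h1 hy
    exact ⟨c • s.operad.one, z, by rw [map_smul, s.operad.diff_one, smul_zero],
      by rw [map_smul, homApp_one]⟩

/-- The free model with no generators. -/
@[reducible] def initial (P : DGOperad k) : FreeModel P where
  M := GradedSigmaModule.trivial k
  d := { app := fun _ => 0
         app_mem := fun _ _ _ _ => Submodule.zero_mem _
         app_act := fun _ _ _ => by simp }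
  diff_d _ _ := map_zero _
  f := GradedSigmaModule.Hom.zero _ _
  f_d _ _ := (map_zero _).trans (map_zero _).symm

/-- The operad without generators is initial. -/
def isInitial (P : DGOperad k) : IsInitial (initial P).operad :=
  IsInitial.ofUniqueHom
    (fun Q => dgHom (lift (GradedSigmaModule.Hom.zero _ _)) fun n x => by
      rw [lift_of]
      exact (map_zero _).trans (map_zero _).symm)
    fun Q φ => dgHom_ext fun n x => by
      rw [Subsingleton.elim (α := (GradedSigmaModule.trivial k).obj n) x 0]
      simp only [map_zero]

section Step

variable [CharZero k] (n : ℕ)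

/-- The generators of arity `n` attached to a free model. -/
@[reducible] noncomputable def generators : GradedSigmaModule k :=
  attachedGenerators s.toTarget n

/-- The graded operad morphism underlying `inclusion`. -/
noncomputable def gradedInclusion :
    GradedOperad.Hom (freeOperad s.M) (freeOperad (s.M.sum (s.generators n))) :=
  map (Hom.inl s.M (s.generators n))

/-- The differential on generators of `step`. -/
noncomputable def stepDiff : GradedSigmaModule.ShiftHom (s.M.sum (s.generators n))
    (freeOperad (s.M.sum (s.generators n))).toGradedSigmaModule where
  app m := (s.gradedInclusion n).app m ∘ₗ
    (s.d.app m).coprod ((attachingMap s.toTarget n).app m)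
  app_mem m p x hx := (s.gradedInclusion n).app_mem m _ _
    (Submodule.add_mem _ (s.d.app_mem m p _ hx.1) ((attachingMap s.toTarget n).app_mem m p _ hx.2))
  app_act m σ x := by
    refine Eq.trans (congrArg ((s.gradedInclusion n).app m) ?_)
      ((s.gradedInclusion n).app_act m σ _)
    change s.d.app m (s.M.act m σ x.1) +
      (attachingMap s.toTarget n).app m ((s.generators n).act m σ x.2) =
      (freeOperad s.M).act m σ (s.d.app m x.1 + (attachingMap s.toTarget n).app m x.2)
    rw [map_add, s.d.app_act, (attachingMap s.toTarget n).app_act]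

theorem stepDiff_apply {m : ℕ} (x : (s.M.sum (s.generators n)).obj m) :
    (s.stepDiff n).app m x = (s.gradedInclusion n).app m (s.d.app m x.1) +
      (s.gradedInclusion n).app m ((attachingMap s.toTarget n).app m x.2) :=
  map_add ((s.gradedInclusion n).app m) _ _

/-- Stated for derivations and not for dg operads, since it is needed to prove that the new
differential squares to zero. -/
theorem gradedInclusion_diff (m : ℕ) (x : (freeOperad s.M).obj m) :
    (s.gradedInclusion n).app m ((FreeOperad.derivation s.d).app m x) =
      (FreeOperad.derivation (s.stepDiff n)).app m ((s.gradedInclusion n).app m x) := by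
  refine app_derivation _ _ _ (fun m x => ?_) m x
  rw [derivation_of, gradedInclusion, map_of, derivation_of, stepDiff_apply]
  change _ = _ + (s.gradedInclusion n).app m ((attachingMap s.toTarget n).app m 0)
  rw [map_zero, map_zero, add_zero]
  rfl

/-- The free model obtained by attaching generators of arity `n`. -/
@[reducible] noncomputable def step : FreeModel P where
  M := s.M.sum (s.generators n)
  d := s.stepDiff n
  diff_d m x := by
    -- The new generators are attached along cocycles, and the old differential squares to zero;
    -- both facts are carried over by the inclusion.
    have h : (FreeOperad.derivation s.d).app m ((attachingMap s.toTarget n).app m x.2) = 0 :=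
      diff_attachingMap s.toTarget n x.2
    rw [stepDiff_apply, map_add, ← gradedInclusion_diff, ← gradedInclusion_diff, s.diff_d, h,
      map_zero, add_zero]
  f := Hom.coprod s.f (attachedMap s.toTarget n)
  f_d m x := by
    have hl : ∀ y, (lift (Hom.coprod s.f (attachedMap s.toTarget n))).app m
        ((s.gradedInclusion n).app m y) = (lift s.f).app m y := fun y =>
      lift_map _ _ _ (fun m x => by
        change s.f.app m x + (attachedMap s.toTarget n).app m 0 = _
        rw [map_zero, add_zero]) m y
    have h : (lift s.f).app m ((attachingMap s.toTarget n).app m x.2) =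
        P.diff m ((attachedMap s.toTarget n).app m x.2) :=
      (diff_attachedMap s.toTarget n x.2).symm
    rw [stepDiff_apply, map_add, hl, hl, s.f_d, h, ← map_add]
    rfl

/-- The inclusion of a free model into the one with more generators. -/
noncomputable def inclusion : s.operad ⟶ (s.step n).operad :=
  DGOperad.Hom.mk (s.gradedInclusion n) (s.gradedInclusion_diff n)

theorem inclusion_of {m : ℕ} (x : s.M.obj m) : homApp (s.inclusion n) m ((of s.M).app m x) =
    (of (s.step n).M).app m ((Hom.inl s.M (s.generators n)).app m x) :=
  map_of _ x

theorem inclusion_toTarget : s.inclusion n ≫ (s.step n).toTarget = s.toTarget :=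
  dgHom_ext fun m x => by
    rw [homApp_comp, inclusion_of]
    refine (lift_of _ _).trans (Eq.trans ?_ (lift_of s.f x).symm)
    change s.f.app m x + (attachedMap s.toTarget n).app m 0 = _
    rw [map_zero, add_zero]

theorem step_diff_inr {m : ℕ} (e : (s.generators n).obj m) :
    (s.step n).operad.diff m
      ((of (s.step n).M).app m ((Hom.inr s.M (s.generators n)).app m e)) =
      homApp (s.inclusion n) m ((attachingMap s.toTarget n).app m e) := by
  refine ((s.step n).diff_of _).trans ((s.stepDiff_apply n _).trans ?_)
  change (s.gradedInclusion n).app m (s.d.app m 0) + _ = _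
  rw [map_zero, map_zero, zero_add]
  rfl

theorem of_step {m : ℕ} (x : (s.step n).M.obj m) : (of (s.step n).M).app m x =
    homApp (s.inclusion n) m ((of s.M).app m x.1) +
      (of (s.step n).M).app m ((Hom.inr s.M (s.generators n)).app m x.2) := by
  rw [inclusion_of, ← map_add]
  congr 1
  exact Prod.ext (add_zero _).symm (zero_add _).symm

theorem inclusion_injective (m : ℕ) : Function.Injective (homApp (s.inclusion n) m) :=
  map_injective (Hom.inl s.M (s.generators n)) (Hom.fst s.M (s.generators n)) (fun _ _ => rfl) m

theorem step_subsingleton {m : ℕ} (h : Subsingleton (s.M.obj m)) (hm : m ≠ n) :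
    Subsingleton ((s.step n).M.obj m) := by
  have := attachedGenerators_subsingleton s.toTarget n hm
  exact inferInstanceAs (Subsingleton (s.M.obj m × (s.generators n).obj m))

theorem exists_of_eq_inclusion {m : ℕ} (hm : m < n) (x : (s.step n).M.obj m) :
    ∃ y, (of (s.step n).M).app m x = homApp (s.inclusion n) m y := by
  have := attachedGenerators_subsingleton s.toTarget n hm.ne
  refine ⟨(of s.M).app m x.1, ?_⟩
  rw [of_step, Subsingleton.elim x.2 0, map_zero, map_zero, add_zero]

theorem inclusion_surjective (hn : 2 ≤ n) (hM0 : Subsingleton (s.M.obj 0))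
    (hM1 : Subsingleton (s.M.obj 1)) {m : ℕ} (hm : m < n) :
    Function.Surjective (homApp (s.inclusion n) m) :=
  app_surjective (gradedHom (s.inclusion n)) m (s.step_subsingleton n hM0 (by omega))
    (s.step_subsingleton n hM1 (by omega))
    fun _ hi => s.exists_of_eq_inclusion n (lt_of_le_of_lt hi hm)

theorem step_bijective_of_lt (hn : 2 ≤ n) (hM0 : Subsingleton (s.M.obj 0))
    (hM1 : Subsingleton (s.M.obj 1)) {m : ℕ} (hm : m < n)
    (h : Function.Bijective (cohomologyMap s.toTarget m)) :
    Function.Bijective (cohomologyMap (s.step n).toTarget m) :=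
  bijective_cohomologyMap_of_comp (s.inclusion n) _ m
    ⟨s.inclusion_injective n m, s.inclusion_surjective n hn hM0 hM1 hm⟩
    (by rwa [inclusion_toTarget])

theorem exists_eq_inclusion_add (hn : 2 ≤ n) (hM0 : Subsingleton (s.M.obj 0))
    (hM1 : Subsingleton (s.M.obj 1))
    (x : (s.step n).operad.obj n) : ∃ a e,
    x = homApp (s.inclusion n) n a +
      (of (s.step n).M).app n ((Hom.inr s.M (s.generators n)).app n e) := by
  obtain ⟨y, e, rfl⟩ := eq_app_add_of (gradedHom (s.inclusion n)) n
    (s.step_subsingleton n hM0 (by omega)) (s.step_subsingleton n hM1 (by omega))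
    (fun _ hi => s.exists_of_eq_inclusion n hi) x
  refine ⟨y + (of s.M).app n e.1, e.2, ?_⟩
  rw [of_step, map_add, add_assoc]
  rfl

/-- Every element of arity `n` is `a + e` with `a` old and `e` a sum of new generators. That the sum
is direct is not needed: `e` is controlled by the choice of complement. -/
theorem step_bijective (hn : 2 ≤ n) (hM0 : Subsingleton (s.M.obj 0))
    (hM1 : Subsingleton (s.M.obj 1)) :
    Function.Bijective (cohomologyMap (s.step n).toTarget n) := by
  have hι : ∀ a, homApp (s.step n).toTarget n (homApp (s.inclusion n) n a) =
      homApp s.toTarget n a := fun a => by rw [← homApp_comp, inclusion_toTarget]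
  have hE : ∀ e, homApp (s.step n).toTarget n ((of (s.step n).M).app n
      ((Hom.inr s.M (s.generators n)).app n e)) = (attachedMap s.toTarget n).app n e := fun e => by
    refine (lift_of _ _).trans ?_
    change s.f.app n 0 + (attachedMap s.toTarget n).app n e = _
    rw [map_zero, zero_add]
  rw [bijective_cohomologyMap]
  refine ⟨fun x y hx hxy => ?_, fun y hy => ?_⟩
  · obtain ⟨a, e, rfl⟩ := s.exists_eq_inclusion_add n hn hM0 hM1 x
    rw [map_add, step_diff_inr, ← homApp_diff, ← map_add] at hx
    have hae := s.inclusion_injective n n (hx.trans (map_zero _).symm)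
    rw [map_add, hι, hE] at hxy
    -- From `da + de = 0` and `ρ(a) + f(e) = dy`, the cone element of `e` is the coboundary of `(-a,
    -- y)`; as it lies in the complement, it vanishes.
    have he : e = 0 := eq_zero_of_coneCoboundary s.toTarget n e (-a) y
      (by rw [map_neg]; exact eq_neg_of_add_eq_zero_right hae)
      (by rw [map_neg, ← hxy]; abel)
    subst he
    rw [map_zero, add_zero] at hae hxy
    -- What remains is an old cocycle `a` with `ρ(a) = dy`. The cone cocycle `(a, y)` gives `a =
    -- d(e' + a')`, so `a` bounds after the attachment.
    obtain ⟨e', a', x', h1, -⟩ := exists_eq_attached_add s.toTarget n a y hae hxy.symm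
    refine ⟨homApp (s.inclusion n) n a' + (of (s.step n).M).app n
      ((Hom.inr s.M (s.generators n)).app n e'), ?_⟩
    rw [map_add, step_diff_inr, ← homApp_diff, ← map_add, map_zero, map_zero, add_zero, h1,
      add_comm]
  -- A cocycle `y` of `P` is the cone cocycle `(0, y)`. Its decomposition shows that `a + e` is a
  -- cocycle that maps to `y` up to a coboundary.
  · obtain ⟨e, a, x', h1, h2⟩ := exists_eq_attached_add s.toTarget n 0 y (map_zero _)
      (by rw [hy, map_zero])
    refine ⟨homApp (s.inclusion n) n a + (of (s.step n).M).app n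
      ((Hom.inr s.M (s.generators n)).app n e), x', ?_, ?_⟩
    · rw [map_add, step_diff_inr, ← homApp_diff, ← map_add, add_comm, ← h1, map_zero]
    · rw [map_add, hι, hE, h2]
      abel

/-- Attaching generators is a principal extension. -/
noncomputable def principalExtension (hn : 2 ≤ n) (hM0 : Subsingleton (s.M.obj 0))
    (hM1 : Subsingleton (s.M.obj 1)) :
    PrincipalExtension n (s.inclusion n) where
  two_le := hn
  M := s.M
  M_zero := hM0
  M_one := hM1
  inc := of s.M
  inc_free := isFreeOn_of s.M
  E := s.generators n
  E_arity _ hm := attachedGenerators_subsingleton s.toTarget n hm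
  d := (attachingMap s.toTarget n).app n
  d_mem := (attachingMap s.toTarget n).app_mem n
  d_act := (attachingMap s.toTarget n).app_act n
  diff_d := diff_attachingMap s.toTarget n
  gen := (Hom.inr s.M (s.generators n)).comp (of (s.step n).M)
  free := by
    have h : ((of s.M).comp (gradedHom (s.inclusion n)).toSigmaHom).coprod
        ((Hom.inr s.M (s.generators n)).comp (of (s.step n).M)) = of (s.step n).M :=
      GradedSigmaModule.Hom.ext (funext fun m => LinearMap.ext fun x => (s.of_step n x).symm)
    exact (congrArg GradedOperad.IsFreeOn h).mpr (isFreeOn_of (s.step n).M)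
  diff_gen := s.step_diff_inr n

end Step

end FreeModel

end DGOperad

/-! ### Sums of `Σ`-modules concentrated in distinct arities -/

namespace GradedSigmaModule

variable {k : Type u} [Field k]

/-- The identity of `N r` if `r = s`, and zero otherwise. -/
def transport (N : ℕ → GradedSigmaModule k) (r s : ℕ) : Hom (N r) (N s) :=
  if h : r = s then h ▸ Hom.id (N r) else Hom.zero _ _

theorem transport_self (N : ℕ → GradedSigmaModule k) (r : ℕ) {m : ℕ} (x : (N r).obj m) :
    (transport N r r).app m x = x := by
  rw [transport, dif_pos rfl]
  rfl

theorem transport_of_ne (N : ℕ → GradedSigmaModule k) {r s : ℕ} (h : r ≠ s) {m : ℕ}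
    (x : (N r).obj m) : (transport N r s).app m x = 0 := by
  rw [transport, dif_neg h]
  rfl

/-- The graded `Σ`-module that agrees with `N r` in arity `r + 2`. -/
@[reducible] def diagonal (N : ℕ → GradedSigmaModule k) : GradedSigmaModule k where
  -- With `N r` concentrated in arity `r + 2`, this is the direct sum of all `N r`. Truncated
  -- subtraction selects `N 0` in arities 0 and 1, where it then vanishes.
  obj m := (N (m - 2)).obj m
  deg m := (N (m - 2)).deg m
  isInternal m := (N (m - 2)).isInternal m
  act m := (N (m - 2)).act m
  act_one m := (N (m - 2)).act_one m
  act_mul m := (N (m - 2)).act_mul m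
  act_mem m := (N (m - 2)).act_mem m

/-- The map from a summand to the diagonal. -/
def toDiagonal (N : ℕ → GradedSigmaModule k) (r : ℕ) : Hom (N r) (diagonal N) where
  app m := (transport N r (m - 2)).app m
  app_mem m := (transport N r (m - 2)).app_mem m
  app_act m := (transport N r (m - 2)).app_act m

/-- The map out of the diagonal with given components. -/
def fromDiagonal {N : ℕ → GradedSigmaModule k} {L : GradedSigmaModule k}
    (f : ∀ r, Hom (N r) L) : Hom (diagonal N) L where
  app m := (f (m - 2)).app m
  app_mem m := (f (m - 2)).app_mem m
  app_act m := (f (m - 2)).app_act m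

theorem toDiagonal_self (N : ℕ → GradedSigmaModule k) {m : ℕ} (x : (diagonal N).obj m) :
    (toDiagonal N (m - 2)).app m x = x :=
  transport_self N (m - 2) x

/-- `N r` is concentrated in arity `r + 2`, for all `r`. -/
def IsDiagonal (N : ℕ → GradedSigmaModule k) : Prop :=
  ∀ r m, m ≠ r + 2 → Subsingleton ((N r).obj m)

/-- Case distinction without casts: either `r` is the index selected in arity `m`, and the map is
the identity, or `N r` vanishes in arity `m`. -/
theorem toDiagonal_cases {N : ℕ → GradedSigmaModule k} (hN : IsDiagonal N) {m : ℕ}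
    {C : ∀ r, (N r).obj m → (diagonal N).obj m → Prop} (h0 : ∀ r, C r 0 0)
    (h : ∀ x, C (m - 2) x x) (r : ℕ) (x : (N r).obj m) : C r x ((toDiagonal N r).app m x) := by
  by_cases hr : r = m - 2
  · subst hr
    rw [toDiagonal_self]
    exact h x
  · have := hN r m (by omega)
    rw [Subsingleton.elim x 0, map_zero]
    exact h0 r

theorem fromDiagonal_toDiagonal {N : ℕ → GradedSigmaModule k} (hN : IsDiagonal N)
    {L : GradedSigmaModule k} (f : ∀ r, Hom (N r) L) (r : ℕ) {m : ℕ} (x : (N r).obj m) :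
    (fromDiagonal f).app m ((toDiagonal N r).app m x) = (f r).app m x :=
  toDiagonal_cases hN (C := fun r x y => (fromDiagonal f).app m y = (f r).app m x)
    (fun r => by rw [map_zero, map_zero]) (fun _ => rfl) r x

theorem diagonal_subsingleton {N : ℕ → GradedSigmaModule k} (hN : IsDiagonal N) {m : ℕ}
    (hm : m < 2) : Subsingleton ((diagonal N).obj m) :=
  hN (m - 2) m (by omega)

end GradedSigmaModule

/-! ### The tower of stages and its limit -/

namespace DGOperad

variable {k : Type u} [Field k] [CharZero k] (P : DGOperad k)

namespace FreeModel

open FreeOperad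

/-- The stages of the construction of the minimal model: generators of arities `2, …, r + 1`. -/
noncomputable def stage : ℕ → FreeModel P
  | 0 => initial P
  | r + 1 => (stage r).step (r + 2)

/-- The generators attached to `stage P r`. -/
@[reducible] noncomputable def newGenerators (r : ℕ) : GradedSigmaModule k :=
  (stage P r).generators (r + 2)

theorem isDiagonal_newGenerators : IsDiagonal (newGenerators P) := fun r _ hm =>
  attachedGenerators_subsingleton (stage P r).toTarget (r + 2) hm

theorem stage_subsingleton (r : ℕ) {m : ℕ} (hm : m < 2 ∨ r + 2 ≤ m) :
    Subsingleton ((stage P r).M.obj m) := by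
  induction r with
  | zero => exact inferInstanceAs (Subsingleton PUnit)
  | succ r ih => exact (stage P r).step_subsingleton (r + 2) (ih (by omega)) (by omega)

/-- The invariant of the construction. The base case is where the hypotheses on `HP(0)` and `HP(1)`
are used; each further arity is settled by the generators attached in it. -/
theorem bijective_stage (h1 : P.IsCohomologicallyConnected) (h0 : P.IsCohomologicallyNonUnitary)
    (r : ℕ) : ∀ m, m ≤ r + 1 → Function.Bijective (cohomologyMap (stage P r).toTarget m) := by
  have hM0 : ∀ r, Subsingleton ((stage P r).M.obj 0) := fun r =>
    stage_subsingleton P r (by omega)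
  have hM1 : ∀ r, Subsingleton ((stage P r).M.obj 1) := fun r =>
    stage_subsingleton P r (by omega)
  induction r with
  | zero =>
    intro m hm
    obtain rfl | rfl : m = 0 ∨ m = 1 := by omega
    · exact (stage P 0).bijective_cohomologyMap_zero (hM0 0) h0
    · exact (stage P 0).bijective_cohomologyMap_one (hM0 0) (hM1 0) h1
  | succ r ih =>
    intro m hm
    rcases Nat.lt_or_ge m (r + 2) with h | h
    · exact (stage P r).step_bijective_of_lt (r + 2) (by omega) (hM0 r) (hM1 r) h
        (ih m (by omega))
    · obtain rfl : m = r + 2 := by omega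
      exact (stage P r).step_bijective (r + 2) (by omega) (hM0 r) (hM1 r)

/-- The inclusions of the stages. -/
noncomputable def stageInclusion (r : ℕ) : (stage P r).operad ⟶ (stage P (r + 1)).operad :=
  (stage P r).inclusion (r + 2)

/-- The new generators in the next stage. -/
noncomputable def newInclusion (r : ℕ) :
    GradedSigmaModule.Hom (newGenerators P r) (stage P (r + 1)).M :=
  Hom.inr (stage P r).M (newGenerators P r)

/-- The old generators in the next stage. -/
noncomputable def oldInclusion (r : ℕ) :
    GradedSigmaModule.Hom (stage P r).M (stage P (r + 1)).M :=
  Hom.inl (stage P r).M (newGenerators P r)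

theorem exists_old_add_new (r : ℕ) {m : ℕ} (x : (stage P (r + 1)).M.obj m) :
    ∃ y e, x = (oldInclusion P r).app m y + (newInclusion P r).app m e :=
  ⟨x.1, x.2, Prod.ext (add_zero _).symm (zero_add _).symm⟩

theorem stage_f_old (r : ℕ) {m : ℕ} (x : (stage P r).M.obj m) :
    (stage P (r + 1)).f.app m ((oldInclusion P r).app m x) = (stage P r).f.app m x := by
  change (stage P r).f.app m x + (attachedMap (stage P r).toTarget (r + 2)).app m 0 = _
  rw [map_zero, add_zero]

theorem stage_f_new (r : ℕ) {m : ℕ} (e : (newGenerators P r).obj m) :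
    (stage P (r + 1)).f.app m ((newInclusion P r).app m e) =
      (attachedMap (stage P r).toTarget (r + 2)).app m e := by
  change (stage P r).f.app m 0 + (attachedMap (stage P r).toTarget (r + 2)).app m e = _
  rw [map_zero, zero_add]

theorem stageInclusion_of (r : ℕ) {m : ℕ} (x : (stage P r).M.obj m) :
    homApp (stageInclusion P r) m ((of (stage P r).M).app m x) =
      (of (stage P (r + 1)).M).app m ((oldInclusion P r).app m x) :=
  (stage P r).inclusion_of (r + 2) x

theorem diff_new (r : ℕ) {m : ℕ} (e : (newGenerators P r).obj m) :
    (stage P (r + 1)).operad.diff m ((of (stage P (r + 1)).M).app m ((newInclusion P r).app m e)) =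
      homApp (stageInclusion P r) m ((attachingMap (stage P r).toTarget (r + 2)).app m e) :=
  (stage P r).step_diff_inr (r + 2) e

/-- The generators of the minimal model. -/
@[reducible] noncomputable def limitGenerators : GradedSigmaModule k :=
  diagonal (newGenerators P)

/-- The inclusions of the generators of the stages. -/
noncomputable def toLimitGenerators :
    ∀ r, GradedSigmaModule.Hom (stage P r).M (limitGenerators P)
  | 0 => Hom.zero _ _
  | r + 1 => Hom.coprod (toLimitGenerators r) (toDiagonal (newGenerators P) r)

theorem toLimitGenerators_old (r : ℕ) {m : ℕ} (x : (stage P r).M.obj m) :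
    (toLimitGenerators P (r + 1)).app m ((oldInclusion P r).app m x) =
      (toLimitGenerators P r).app m x := by
  change (toLimitGenerators P r).app m x + (toDiagonal (newGenerators P) r).app m 0 = _
  rw [map_zero, add_zero]

theorem toLimitGenerators_new (r : ℕ) {m : ℕ} (e : (newGenerators P r).obj m) :
    (toLimitGenerators P (r + 1)).app m ((newInclusion P r).app m e) =
      (toDiagonal (newGenerators P) r).app m e := by
  change (toLimitGenerators P r).app m 0 + (toDiagonal (newGenerators P) r).app m e = _
  rw [map_zero, zero_add]

/-- The inclusions of new generators into later stages. -/
noncomputable def ofNew : ∀ r q, GradedSigmaModule.Hom (newGenerators P q) (stage P r).M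
  | 0, _ => Hom.zero _ _
  | r + 1, q => Hom.prod (ofNew r q) (transport (newGenerators P) q r)

theorem ofNew_succ (r q : ℕ) {m : ℕ} (e : (newGenerators P q).obj m) :
    (ofNew P (r + 1) q).app m e = (oldInclusion P r).app m ((ofNew P r q).app m e) +
      (newInclusion P r).app m ((transport (newGenerators P) q r).app m e) :=
  Prod.ext (add_zero _).symm (zero_add _).symm

theorem ofNew_eq_zero {r q : ℕ} (h : r ≤ q) {m : ℕ} (e : (newGenerators P q).obj m) :
    (ofNew P r q).app m e = 0 := by
  induction r with
  | zero => rfl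
  | succ r ih =>
    rw [ofNew_succ, ih (by omega), transport_of_ne _ (by omega), map_zero, map_zero, add_zero]

theorem toLimitGenerators_ofNew {r q : ℕ} (h : q < r) {m : ℕ} (e : (newGenerators P q).obj m) :
    (toLimitGenerators P r).app m ((ofNew P r q).app m e) =
      (toDiagonal (newGenerators P) q).app m e := by
  induction r with
  | zero => omega
  | succ r ih =>
    rw [ofNew_succ, map_add, toLimitGenerators_old, toLimitGenerators_new]
    by_cases hq : q = r
    · subst hq
      rw [ofNew_eq_zero P le_rfl, transport_self, map_zero, zero_add]
    · rw [ih (by omega), transport_of_ne _ hq, map_zero, add_zero]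

/-- The retraction of the generators of the minimal model onto those of a stage. -/
noncomputable def retraction (r : ℕ) : GradedSigmaModule.Hom (limitGenerators P) (stage P r).M :=
  fromDiagonal (ofNew P r)

/-- Generators of a stage are a direct summand of all generators; by `map_injective` the stage
therefore embeds in the limit. -/
theorem retraction_toLimitGenerators (r : ℕ) {m : ℕ} (x : (stage P r).M.obj m) :
    (retraction P r).app m ((toLimitGenerators P r).app m x) = x := by
  induction r with
  | zero => exact Subsingleton.elim (α := PUnit) _ _
  | succ r ih =>
    have hret : ∀ y, (retraction P (r + 1)).app m y =
        (oldInclusion P r).app m ((retraction P r).app m y) +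
          (newInclusion P r).app m ((transport (newGenerators P) (m - 2) r).app m y) := fun y =>
      ofNew_succ P r (m - 2) y
    have hnew : ∀ e : (newGenerators P r).obj m,
        (retraction P (r + 1)).app m ((toDiagonal (newGenerators P) r).app m e) =
          (newInclusion P r).app m e := fun e => by
      rw [retraction, fromDiagonal_toDiagonal (isDiagonal_newGenerators P), ofNew_succ,
        ofNew_eq_zero P le_rfl, transport_self, map_zero, zero_add]
    obtain ⟨y, e, rfl⟩ := exists_old_add_new P r x
    rw [map_add, map_add, toLimitGenerators_old, toLimitGenerators_new, hnew, hret, ih]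
    by_cases hm : m - 2 = r
    -- In the arity of the new generators, stage `r` has no generators, so `y = 0`; in other arities
    -- the component of `retraction` in the new generators is zero.
    · have := stage_subsingleton P r (m := m) (by omega)
      rw [Subsingleton.elim y 0]
      simp only [map_zero, add_zero, zero_add]
    · rw [transport_of_ne _ hm, map_zero, add_zero]

/-- The graded operad morphisms underlying `stageToLimit`. -/
noncomputable def gradedStageToLimit (r : ℕ) :
    GradedOperad.Hom (freeOperad (stage P r).M) (freeOperad (limitGenerators P)) :=
  map (toLimitGenerators P r)

theorem gradedStageToLimit_of (r : ℕ) {m : ℕ} (x : (stage P r).M.obj m) :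
    (gradedStageToLimit P r).app m ((of (stage P r).M).app m x) =
      (of (limitGenerators P)).app m ((toLimitGenerators P r).app m x) :=
  map_of _ x

theorem gradedStageToLimit_inclusion (r : ℕ) {m : ℕ} (x : (stage P r).operad.obj m) :
    (gradedStageToLimit P (r + 1)).app m (homApp (stageInclusion P r) m x) =
      (gradedStageToLimit P r).app m x :=
  app_eq (g := (gradedHom (stageInclusion P r)).comp (gradedStageToLimit P (r + 1)))
    (g' := gradedStageToLimit P r)
    (fun m x => by
      change (gradedStageToLimit P (r + 1)).app m (homApp (stageInclusion P r) m _) = _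
      rw [stageInclusion_of, gradedStageToLimit_of, gradedStageToLimit_of, toLimitGenerators_old])
    m x

/-- The differential on the generators of the minimal model. -/
noncomputable def limitDiff : GradedSigmaModule.ShiftHom (limitGenerators P)
    (freeOperad (limitGenerators P)).toGradedSigmaModule where
  app m := (gradedStageToLimit P (m - 2)).app m ∘ₗ
    (attachingMap (stage P (m - 2)).toTarget (m - 2 + 2)).app m
  app_mem m p x hx := (gradedStageToLimit P (m - 2)).app_mem m _ _
    ((attachingMap (stage P (m - 2)).toTarget (m - 2 + 2)).app_mem m p x hx)
  app_act m σ x := by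
    refine Eq.trans (congrArg ((gradedStageToLimit P (m - 2)).app m) ?_)
      ((gradedStageToLimit P (m - 2)).app_act m σ _)
    exact (attachingMap (stage P (m - 2)).toTarget (m - 2 + 2)).app_act m σ x

theorem limitDiff_toDiagonal (r : ℕ) {m : ℕ} (e : (newGenerators P r).obj m) :
    (limitDiff P).app m ((toDiagonal (newGenerators P) r).app m e) =
      (gradedStageToLimit P r).app m ((attachingMap (stage P r).toTarget (r + 2)).app m e) :=
  toDiagonal_cases (isDiagonal_newGenerators P)
    (C := fun r x y => (limitDiff P).app m y = (gradedStageToLimit P r).app m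
      ((attachingMap (stage P r).toTarget (r + 2)).app m x))
    (fun r => by
      rw [map_zero, map_zero]
      exact (map_zero _).symm) (fun _ => rfl) r e

/-- Again stated for derivations: it is what transfers `d² = 0` from the stages to the limit. -/
theorem gradedStageToLimit_diff (r : ℕ) (m : ℕ) (x : (stage P r).operad.obj m) :
    (gradedStageToLimit P r).app m ((stage P r).operad.diff m x) =
      (FreeOperad.derivation (limitDiff P)).app m ((gradedStageToLimit P r).app m x) := by
  induction r generalizing m with
  | zero =>
    refine app_derivation (FreeOperad.derivation (stage P 0).d) _ _ (fun m x => ?_) m x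
    have hx : x = 0 := Subsingleton.elim (α := PUnit) _ _
    simp only [hx, map_zero]
  | succ r ih =>
    refine app_derivation (FreeOperad.derivation (stage P (r + 1)).d) _ _ (fun m x => ?_) m x
    obtain ⟨y, e, rfl⟩ := exists_old_add_new P r x
    simp only [map_add]
    congr 1
    · rw [← stageInclusion_of, gradedStageToLimit_inclusion, ← ih]
      have := homApp_diff (stageInclusion P r) m ((of (stage P r).M).app m y)
      exact (congrArg _ this.symm).trans (gradedStageToLimit_inclusion P r _)
    · refine (congrArg _ (diff_new P r e)).trans ?_
      rw [gradedStageToLimit_inclusion, gradedStageToLimit_of, toLimitGenerators_new, derivation_of,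
        limitDiff_toDiagonal]

/-- The structure morphism of the minimal model on generators. -/
noncomputable def limitMap :
    GradedSigmaModule.Hom (limitGenerators P) P.toGradedSigmaModule :=
  fromDiagonal fun r => attachedMap (stage P r).toTarget (r + 2)

theorem limitMap_toLimitGenerators (r : ℕ) {m : ℕ} (x : (stage P r).M.obj m) :
    (limitMap P).app m ((toLimitGenerators P r).app m x) = (stage P r).f.app m x := by
  induction r with
  | zero =>
    have hx : x = 0 := Subsingleton.elim (α := PUnit) _ _
    simp only [hx, map_zero]
  | succ r ih =>
    obtain ⟨y, e, rfl⟩ := exists_old_add_new P r x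
    rw [map_add, map_add, map_add, toLimitGenerators_old, toLimitGenerators_new, ih, limitMap,
      fromDiagonal_toDiagonal (isDiagonal_newGenerators P), stage_f_old, stage_f_new]

theorem lift_limitMap (r : ℕ) {m : ℕ} (x : (stage P r).operad.obj m) :
    (lift (limitMap P)).app m ((gradedStageToLimit P r).app m x) = (lift (stage P r).f).app m x :=
  lift_map _ _ _ (fun _ x => limitMap_toLimitGenerators P r x) m x

/-- The minimal model, as a free model. -/
@[reducible] noncomputable def limit : FreeModel P where
  M := limitGenerators P
  d := limitDiff P
  diff_d m x := by
    -- The differential of a generator of arity `m` comes from stage `m - 2`, where it is a cocycle.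
    refine (gradedStageToLimit_diff P (m - 2) m _).symm.trans ?_
    refine (congrArg _ (diff_attachingMap (stage P (m - 2)).toTarget (m - 2 + 2) x)).trans ?_
    exact map_zero _
  f := limitMap P
  f_d m x := (lift_limitMap P (m - 2) _).trans
    (diff_attachedMap (stage P (m - 2)).toTarget (m - 2 + 2) x).symm

/-- The morphisms from the stages to the minimal model. -/
noncomputable def stageToLimit (r : ℕ) : (stage P r).operad ⟶ (limit P).operad :=
  DGOperad.Hom.mk (gradedStageToLimit P r) (gradedStageToLimit_diff P r)

theorem stageToLimit_of (r : ℕ) {m : ℕ} (x : (stage P r).M.obj m) :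
    homApp (stageToLimit P r) m ((of (stage P r).M).app m x) =
      (of (limitGenerators P)).app m ((toLimitGenerators P r).app m x) :=
  gradedStageToLimit_of P r x

theorem stageInclusion_stageToLimit (r : ℕ) :
    stageInclusion P r ≫ stageToLimit P (r + 1) = stageToLimit P r :=
  dgHom_ext fun _ _ => gradedStageToLimit_inclusion P r _

theorem stageToLimit_toTarget (r : ℕ) :
    stageToLimit P r ≫ (limit P).toTarget = (stage P r).toTarget :=
  dgHom_ext fun _ _ => lift_limitMap P r _

theorem limitGenerators_subsingleton {m : ℕ} (hm : m < 2) :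
    Subsingleton ((limitGenerators P).obj m) :=
  diagonal_subsingleton (isDiagonal_newGenerators P) hm

theorem exists_toLimitGenerators_eq {r m : ℕ} (hm : m ≤ r + 1) (x : (limitGenerators P).obj m) :
    ∃ y, x = (toLimitGenerators P r).app m y := by
  rcases Nat.lt_or_ge m 2 with h | h
  · have := limitGenerators_subsingleton P h
    exact ⟨0, Subsingleton.elim _ _⟩
  · exact ⟨(ofNew P r (m - 2)).app m x, by
      rw [toLimitGenerators_ofNew P (by omega), toDiagonal_self]⟩

/-- All generators of arity at most `r + 1` are already present at stage `r`, and without generators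
of arity 0 or 1 those of arity above `m` cannot contribute to arity `m`. -/
theorem stageToLimit_bijective {r m : ℕ} (hm : m ≤ r + 1) :
    Function.Bijective (homApp (stageToLimit P r) m) := by
  refine ⟨map_injective (toLimitGenerators P r) (retraction P r)
    (fun _ x => retraction_toLimitGenerators P r x) m, ?_⟩
  refine app_surjective (gradedHom (stageToLimit P r)) m
    (limitGenerators_subsingleton P (by omega)) (limitGenerators_subsingleton P (by omega))
    fun i hi x => ?_
  obtain ⟨y, rfl⟩ := exists_toLimitGenerators_eq P (r := r) (by omega) x
  exact ⟨_, (stageToLimit_of P r y).symm⟩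

theorem isQuasiIso_limit (h1 : P.IsCohomologicallyConnected)
    (h0 : P.IsCohomologicallyNonUnitary) : IsQuasiIso (limit P).toTarget := fun m =>
  bijective_cohomologyMap_of_comp (stageToLimit P m) _ m
    (stageToLimit_bijective P (by omega))
    (by
      rw [stageToLimit_toTarget]
      exact bijective_stage P h1 h0 m m (by omega))

theorem isNonUnitary_limit : (limit P).operad.IsNonUnitary :=
  ⟨fun x y => (eq_zero_of_arity_zero (limitGenerators_subsingleton P (by omega)) x).trans
    (eq_zero_of_arity_zero (limitGenerators_subsingleton P (by omega)) y).symm⟩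

/-- The unit spans arity one because of the generators' arities. It is nonzero because its image in
`P` is not a coboundary. -/
theorem isConnected_limit (h1 : P.IsCohomologicallyConnected) :
    (limit P).operad.IsConnected := by
  constructor
  · intro c c' h
    have h' : c • P.one = c' • P.one := by
      have := congrArg (homApp (limit P).toTarget 1) h
      simp only at this
      rwa [map_smul, map_smul, homApp_one] at this
    refine sub_eq_zero.1 (smul_one_injective_of_coboundary h1 (y := 0) ?_)
    rw [sub_smul, h', sub_self, map_zero]
  · intro x
    obtain ⟨c, hc⟩ := exists_smul_one (limitGenerators_subsingleton P (by omega))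
      (limitGenerators_subsingleton P (by omega)) x
    exact ⟨c, hc.symm⟩

/-! ### The limit of the stages as a colimit of dg operads -/

section Colimit

variable {P} {X : DGOperad k} (c : ∀ r, (stage P r).operad ⟶ X)

/-- The restriction of a family of morphisms from the stages to the new generators. -/
noncomputable def newComponent (r : ℕ) :
    GradedSigmaModule.Hom (newGenerators P r) X.toGradedSigmaModule :=
  ((newInclusion P r).comp (of (stage P (r + 1)).M)).comp (gradedHom (c (r + 1))).toSigmaHom

theorem newComponent_apply (r : ℕ) {m : ℕ} (e : (newGenerators P r).obj m) :
    (newComponent c r).app m e =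
      homApp (c (r + 1)) m ((of (stage P (r + 1)).M).app m ((newInclusion P r).app m e)) :=
  rfl

/-- A compatible family is determined by its values on the generators new at each stage, since
compatibility carries the old ones down to the previous stage. -/
theorem lift_newComponent (hc : ∀ r, stageInclusion P r ≫ c (r + 1) = c r) (r : ℕ) {m : ℕ}
    (x : (stage P r).operad.obj m) :
    (lift (fromDiagonal (newComponent c))).app m ((gradedStageToLimit P r).app m x) =
      homApp (c r) m x := by
  refine app_eq (g := (gradedStageToLimit P r).comp (lift (fromDiagonal (newComponent c))))
    (g' := gradedHom (c r)) (fun i y => ?_) m x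
  clear x
  change (lift (fromDiagonal (newComponent c))).app i ((gradedStageToLimit P r).app i _) =
    homApp (c r) i _
  rw [gradedStageToLimit_of, lift_of]
  induction r with
  | zero =>
    have hy : y = 0 := Subsingleton.elim (α := PUnit) _ _
    simp only [hy, map_zero]
  | succ r ih =>
    obtain ⟨z, e, rfl⟩ := exists_old_add_new P r y
    simp only [map_add]
    rw [toLimitGenerators_old, toLimitGenerators_new, ih z,
      fromDiagonal_toDiagonal (isDiagonal_newGenerators P), ← stageInclusion_of,
      newComponent_apply, ← homApp_comp, hc]

/-- The morphism from the minimal model induced by compatible morphisms from the stages. -/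
noncomputable def limitDesc (hc : ∀ r, stageInclusion P r ≫ c (r + 1) = c r) :
    (limit P).operad ⟶ X :=
  dgHom (lift (fromDiagonal (newComponent c))) fun m x => by
    have h1 : (limitDiff P).app m x = (gradedStageToLimit P (m - 2)).app m
        ((attachingMap (stage P (m - 2)).toTarget (m - 2 + 2)).app m x) := rfl
    have h2 : (fromDiagonal (newComponent c)).app m x = (newComponent c (m - 2)).app m x := rfl
    rw [h1, lift_newComponent c hc, lift_of, h2, newComponent_apply, ← homApp_diff, diff_new,
      ← homApp_comp, hc]

theorem stageToLimit_limitDesc (hc : ∀ r, stageInclusion P r ≫ c (r + 1) = c r) (r : ℕ) :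
    stageToLimit P r ≫ limitDesc c hc = c r :=
  dgHom_ext fun _ _ => lift_newComponent c hc r _

theorem eq_of_stageToLimit {φ ψ : (limit P).operad ⟶ X}
    (h : ∀ r, stageToLimit P r ≫ φ = stageToLimit P r ≫ ψ) : φ = ψ :=
  dgHom_ext fun m x => by
    -- A generator of arity `m` is already present at stage `m`, so agreement on the stages gives
    -- agreement on all generators.
    obtain ⟨y, rfl⟩ := exists_toLimitGenerators_eq P (r := m) (by omega) x
    rw [← stageToLimit_of, ← homApp_comp, ← homApp_comp, h]

end Colimit

/-- The sequence of the stages. -/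
noncomputable def stageFunctor : ℕ ⥤ DGOperad.{u} k :=
  Functor.ofSequence (X := fun r => (stage P r).operad) (stageInclusion P)

theorem stageFunctor_map (r : ℕ) :
    (stageFunctor P).map (homOfLE (Nat.le_succ r)) = stageInclusion P r :=
  Functor.ofSequence_map_homOfLE_succ (X := fun r => (stage P r).operad) (stageInclusion P) r

/-- The cocone of the minimal model over its stages. -/
noncomputable def stageCocone : stageFunctor P ⟶ (Functor.const ℕ).obj (limit P).operad :=
  NatTrans.ofSequence (stageToLimit P) fun r => by
    refine (congrArg (fun f => f ≫ stageToLimit P (r + 1)) (stageFunctor_map P r)).trans ?_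
    exact (stageInclusion_stageToLimit P r).trans (Category.comp_id _).symm

/-- The minimal model is the colimit of its stages. -/
noncomputable def isColimitStageCocone : IsColimit (Cocone.mk (limit P).operad (stageCocone P)) :=
  have hc : ∀ (s : Cocone (stageFunctor P)) (r : ℕ),
      stageInclusion P r ≫ s.ι.app (r + 1) = s.ι.app r := fun s r => by
    have := s.w (homOfLE (Nat.le_succ r))
    rwa [stageFunctor_map] at this
  { desc := fun s => limitDesc (fun r => s.ι.app r) (hc s)
    fac := fun s r => stageToLimit_limitDesc (fun r => s.ι.app r) (hc s) r
    uniq := fun s _ hφ => eq_of_stageToLimit fun r =>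
      (hφ r).trans (stageToLimit_limitDesc (fun r => s.ι.app r) (hc s) r).symm }

theorem isSullivanMinimal_limit : IsSullivanMinimal (limit P).operad :=
  ⟨stageFunctor P, stageCocone P, ⟨isInitial P⟩, fun r => ⟨by
    rw [stageFunctor_map]
    exact (stage P r).principalExtension (r + 2) (by omega) (stage_subsingleton P r (by omega))
      (stage_subsingleton P r (by omega))⟩, ⟨isColimitStageCocone P⟩⟩

end FreeModel

end DGOperad

theorem theorem5p1 {k : Type*} [Field k] [CharZero k] (P : DGOperad k)
    (h1 : P.IsCohomologicallyConnected) (h0 : P.IsCohomologicallyNonUnitary) :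
    ∃ (S : DGOperad k) (ρ : S ⟶ P),
      DGOperad.IsSullivanMinimalModel ρ ∧
      (∃ (M : GradedSigmaModule k) (i : GradedSigmaModule.Hom M S.toGradedSigmaModule),
        Subsingleton (M.obj 0) ∧ Subsingleton (M.obj 1) ∧ GradedOperad.IsFreeOn i) ∧
      S.IsConnected ∧ S.IsNonUnitary :=
  ⟨(DGOperad.FreeModel.limit P).operad, (DGOperad.FreeModel.limit P).toTarget,
    ⟨DGOperad.FreeModel.isSullivanMinimal_limit P, DGOperad.FreeModel.isQuasiIso_limit P h1 h0⟩,
    ⟨DGOperad.FreeModel.limitGenerators P, FreeOperad.of _,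
      DGOperad.FreeModel.limitGenerators_subsingleton P (by omega),
      DGOperad.FreeModel.limitGenerators_subsingleton P (by omega), FreeOperad.isFreeOn_of _⟩,
    DGOperad.FreeModel.isConnected_limit P h1, DGOperad.FreeModel.isNonUnitary_limit P⟩
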